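/- Let $G$ be a finite abelian group, written additively, of type $(m_1,\dots,m_r)$; that is, $1\neq m_1\mid\cdots\mid m_r$ and $G\cong\mathbb Z_{m_1}\oplus\cdots\oplus\mathbb Z_{m_r}$. Put $\operatorname{rk}(G)=r$ and $\nu_k(G)=\#\{i : m_i=k\}$. For $A\subseteq G$ put $A^{\pm}=(-A)\cup\{0\}\cup A$ and, for an integer $\rho\ge 0$, $\langle A\rangle_\rho=\{a_1+\cdots+a_\rho : a_i\in A^{\pm}\}$ (so $\langle A\rangle_0=\{0\}$). Let $\operatorname{diam}_A(G)=\min\{\rho\ge 0 : \langle A\rangle_\rho=G\}$, with $\min\varnothing=\infty$, and $\operatorname{diam}(G)=\max\{\operatorname{diam}_A(G) : \langle A\rangle=G\}$. A set $A\subseteq G$ is *$\rho$-maximal* if it is maximal under inclusion subject to $\operatorname{diam}_A(G)\ge\rho$, and *aperiodic* if $\{g\in G : A+g=A\}=\{0\}$. With the convention $\max\varnothing=0$, let $$\mathbf s_\rho(G)=\max\{|A| : A\subseteq G,\ \rho\le\operatorname{diam}_A(G)<\infty\},$$ $$\mathbf t_\rho(G)=\max\{|A| : A \text{ is an aperiodic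 } \rho\text{-maximal generating set for } G\}.$$ Suppose that $\rho:=\operatorname{diam}(G)\ge 2$. Then $$\mathbf t_\rho(G)=\mathbf s_\rho(G)=1+2\operatorname{rk}(G)-\nu_2(G)+2\lfloor \nu_3(G)/2\rfloor .$$ Moreover, let $b_1,\dots,b_r$ be any standard generating set for $G$, that is, $G=\langle b_1\rangle\oplus\cdots\oplus\langle b_r\rangle$ with $\operatorname{ord}(b_i)=m_i$ for all $i$. Then $$A=\bigl(\{b_1,\dots,b_r\}\cup\{b_{2i-1}+b_{2i} : 1\le i\le \nu_3(G)/2\}\bigr)^{\pm}$$ is an aperiodic $\rho$-maximal generating set for $G$ of cardinality $1+2\operatorname{rk}(G)-\nu_2(G)+2\lfloor \nu_3(G)/2\rfloor$. -/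

import Mathlib

open scoped Pointwise

namespace FinAbDiam

/-! ### Lengths and diameters -/

section Diameter

variable {G : Type*} [AddCommGroup G]

/-- The symmetric closure `A^± = (-A) ∪ {0} ∪ A`. -/
def symmClosure (A : Set G) : Set G := -A ∪ {0} ∪ A

/-- `⟨A⟩_ρ = {a₁ + ⋯ + a_ρ : aᵢ ∈ A^±}`, which is `{0}` for `ρ = 0`. -/
def reach (A : Set G) (ρ : ℕ) : Set G :=
  {g | ∃ a : Fin ρ → G, (∀ i, a i ∈ symmClosure A) ∧ ∑ i, a i = g}

/-- `diam_A(G) = min {ρ ∈ ℕ₀ : ⟨A⟩_ρ = G}`, with `min ∅ = ∞`. -/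
noncomputable def diamWith (A : Set G) : ℕ∞ :=
  sInf {d : ℕ∞ | ∃ ρ : ℕ, d = ρ ∧ reach A ρ = Set.univ}

variable (G) in
/-- The absolute diameter `diam(G) = max {diam_A(G) : ⟨A⟩ = G}`. For a finite group this is the
maximum of a non-empty finite set of natural numbers. -/
noncomputable def absDiam : ℕ :=
  sSup {d : ℕ | ∃ A : Set G, AddSubgroup.closure A = ⊤ ∧ diamWith A = d}

variable (G) in
/-- `s_ρ(G)`, the maximum size of a set `A` with `ρ ≤ diam_A(G) < ∞`, where `max ∅ = 0`. -/
noncomputable def sInvariant (ρ : ℕ) : ℕ :=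
  sSup {n : ℕ | ∃ A : Set G, (ρ : ℕ∞) ≤ diamWith A ∧ diamWith A < ⊤ ∧ A.ncard = n}

/-- `A` is aperiodic: its period, the subgroup of all `g` with `g + A = A`, is trivial. -/
def Aperiodic (A : Set G) : Prop := AddAction.stabilizer G A = ⊥

/-- `A` is `ρ`-maximal: maximal under inclusion subject to `diam_A(G) ≥ ρ`. -/
def RhoMaximal (ρ : ℕ) (A : Set G) : Prop :=
  Maximal (fun B : Set G => (ρ : ℕ∞) ≤ diamWith B) A

variable (G) in
/-- `t_ρ(G)`, the maximum size of an aperiodic `ρ`-maximal generating set, where `max ∅ = 0`. -/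
noncomputable def tInvariant (ρ : ℕ) : ℕ :=
  sSup {n : ℕ | ∃ A : Set G,
    Aperiodic A ∧ RhoMaximal ρ A ∧ AddSubgroup.closure A = ⊤ ∧ A.ncard = n}

end Diameter

/-! ### The type of a finite abelian group -/

/-- `G` is of type `(m₁, …, m_r)`: `1 ≠ m₁ ∣ ⋯ ∣ m_r` and `G ≅ ℤ_{m₁} ⊕ ⋯ ⊕ ℤ_{m_r}`. -/
def IsOfType (G : Type*) [AddCommGroup G] {r : ℕ} (m : Fin r → ℕ) : Prop :=
  (∀ i, 1 < m i) ∧ (∀ i j, i ≤ j → m i ∣ m j) ∧ Nonempty (G ≃+ ((i : Fin r) → ZMod (m i)))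

/-- An element of maximal order generates a direct summand. -/
theorem exists_isCompl_zmultiples (G : Type*) [AddCommGroup G] [Finite G] (g : G)
    (hg : addOrderOf g = AddMonoid.exponent G) :
    ∃ H : AddSubgroup G, IsCompl H (AddSubgroup.zmultiples g) := by
  set n := AddMonoid.exponent G with hn
  have hn0 : n ≠ 0 := AddMonoid.exponent_ne_zero_of_finite
  have : NeZero n := ⟨hn0⟩
  let P := Multiplicative G
  have hexp : Monoid.exponent P = n := by
    rw [hn]; exact Monoid.exponent_multiplicative
  have : NeZero (Monoid.exponent P) := ⟨hexp ▸ hn0⟩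
  let x : P := Multiplicative.ofAdd g
  have hx : orderOf x = n := by rw [orderOf_ofAdd_eq_addOrderOf, hg]
  obtain ⟨ζ, hζ⟩ : ∃ ζ : ℂˣ, IsPrimitiveRoot ζ n := by
    have h := Complex.isPrimitiveRoot_exp n hn0
    exact ⟨_, (h.isUnit_unit hn0)⟩
  let z : Subgroup.zpowers x := ⟨x, Subgroup.mem_zpowers x⟩
  have hz : ∀ y : Subgroup.zpowers x, y ∈ Subgroup.zpowers z := by
    rintro ⟨y, k, rfl⟩
    exact ⟨k, by ext; simp [z]⟩
  have hzo : orderOf ζ ∣ orderOf z := by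
    rw [← hζ.eq_orderOf, Subgroup.orderOf_mk, hx]
  let f : Subgroup.zpowers x →* ℂˣ := monoidHomOfForallMemZpowers hz hzo
  obtain ⟨ψ, hψ⟩ := MonoidHom.domRestrict_surjective (M := ℂ) (Subgroup.zpowers x) f
  have hψx : ψ x = ζ := by
    have h1 : ψ x = f z := by rw [← hψ]; rfl
    rw [h1]; exact monoidHomOfForallMemZpowers_apply_gen hz hzo
  let φ : G →+ Additive ℂˣ := MonoidHom.toAdditiveRight ψ
  refine ⟨φ.ker, ?_, ?_⟩
  · rw [AddSubgroup.disjoint_def]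
    rintro y hy ⟨k, rfl⟩
    have h1 : ζ ^ k = 1 := by
      rw [← hψx, ← map_zpow]
      exact hy
    have h2 : (n : ℤ) ∣ k := (hζ.zpow_eq_one_iff_dvd k).1 h1
    rw [← hg] at h2
    exact addOrderOf_dvd_iff_zsmul_eq_zero.1 h2
  · rw [codisjoint_iff, eq_top_iff]
    intro y _
    have h1 : (ψ (Multiplicative.ofAdd y)) ^ n = 1 := by
      rw [← map_pow, ← hexp, Monoid.pow_exponent_eq_one, map_one]
    obtain ⟨k, -, hk⟩ := (IsPrimitiveRoot.coe_units_iff.2 hζ).eq_pow_of_pow_eq_one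
      (by rw [← Units.val_pow_eq_pow_val, h1, Units.val_one])
    replace hk : ζ ^ k = ψ (Multiplicative.ofAdd y) := Units.ext (by simpa using hk)
    refine AddSubgroup.mem_sup.2 ⟨y - k • g, ?_, k • g,
      AddSubgroup.nsmul_mem_zmultiples g k, by abel⟩
    have h2 : ψ (Multiplicative.ofAdd (y - k • g)) = 1 := by
      have : Multiplicative.ofAdd (y - k • g) = Multiplicative.ofAdd y / x ^ k := rfl
      rw [this, map_div, map_pow, hψx, hk, div_self']
    exact h2

/-- Every finite abelian group has a type. -/
theorem exists_isOfType (G : Type*) [AddCommGroup G] [Finite G] :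
    ∃ (r : ℕ) (m : Fin r → ℕ), IsOfType G m := by
  induction hc : Nat.card G using Nat.strong_induction_on generalizing G with
  | _ c ih =>
  rcases subsingleton_or_nontrivial G with hG | hG
  · exact ⟨0, Fin.elim0, fun i => i.elim0, fun i => i.elim0,
      ⟨{ toFun := fun _ i => i.elim0, invFun := fun _ => 0,
         left_inv := fun _ => Subsingleton.elim _ _, right_inv := fun _ => Subsingleton.elim _ _,
         map_add' := fun _ _ => Subsingleton.elim _ _ }⟩⟩
  obtain ⟨g, hg⟩ := AddMonoid.exists_addOrderOf_eq_exponent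
    (AddMonoid.ExponentExists.of_finite (G := G))
  obtain ⟨H, hH⟩ := exists_isCompl_zmultiples G g hg
  set n := AddMonoid.exponent G with hn
  have hn1 : 1 < n := AddMonoid.one_lt_exponent
  have hmul : Nat.card H * n = Nat.card G := by
    have h := Nat.card_congr
      (Submodule.prodEquivOfIsCompl (AddSubgroup.toIntSubmodule H)
        (AddSubgroup.toIntSubmodule (AddSubgroup.zmultiples g))
        ((AddSubgroup.toIntSubmodule (M := G)).isCompl_iff.1 hH)).toEquiv
    rw [Nat.card_prod] at h
    rw [← h, ← hg, ← Nat.card_zmultiples]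
    rfl
  have hpos : 0 < Nat.card H := Nat.card_pos
  obtain ⟨r, m, hm1, hm2, ⟨e⟩⟩ := ih (Nat.card H) (by nlinarith) H rfl
  have hdvd : ∀ i, m i ∣ n := by
    intro i
    have h1 : addOrderOf (e.symm (Pi.single i 1)) = m i := by
      rw [AddEquiv.addOrderOf_eq]
      exact (addOrderOf_injective (AddMonoidHom.single (fun i => ZMod (m i)) i)
        (fun a b h => Pi.single_injective (M := fun i => ZMod (m i)) i h) 1).trans (ZMod.addOrderOf_one _)
    have h2 : addOrderOf ((e.symm (Pi.single i 1) : H) : G) = m i := by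
      rw [AddSubgroup.addOrderOf_coe, h1]
    rw [← h2]
    exact AddMonoid.addOrder_dvd_exponent _
  let M : Fin (r + 1) → ℕ := Fin.snoc m n
  have hMl : M (Fin.last r) = n := Fin.snoc_last _ _
  have hMc : ∀ i : Fin r, M i.castSucc = m i := fun i => Fin.snoc_castSucc _ _ _
  refine ⟨r + 1, M, ?_, ?_, ?_⟩
  · intro i
    induction i using Fin.lastCases with
    | last => rw [hMl]; exact hn1
    | cast i => rw [hMc]; exact hm1 i
  · intro i j
    induction j using Fin.lastCases with
    | last =>
      intro _
      rw [hMl]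
      induction i using Fin.lastCases with
      | last => rw [hMl]
      | cast i => rw [hMc]; exact hdvd i
    | cast j =>
      induction i using Fin.lastCases with
      | last => intro h; exact absurd h (not_le.2 (Fin.castSucc_lt_last j))
      | cast i => intro h; rw [hMc, hMc]; exact hm2 i j (Fin.castSucc_le_castSucc_iff.1 h)
  · let e1 : (H × AddSubgroup.zmultiples g) ≃+ G :=
      (Submodule.prodEquivOfIsCompl (AddSubgroup.toIntSubmodule H)
        (AddSubgroup.toIntSubmodule (AddSubgroup.zmultiples g))
        ((AddSubgroup.toIntSubmodule (M := G)).isCompl_iff.1 hH)).toAddEquiv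
    have hcard : Nat.card (AddSubgroup.zmultiples g) = n := by rw [Nat.card_zmultiples, hg]
    let e2 : ZMod (Nat.card (AddSubgroup.zmultiples g)) ≃+ AddSubgroup.zmultiples g :=
      zmodAddCyclicAddEquiv inferInstance
    let e3 : ZMod (M (Fin.last r)) ≃+ AddSubgroup.zmultiples g :=
      (ZMod.ringEquivCongr (hMl.trans hcard.symm)).toAddEquiv.trans e2
    let e4 : H ≃+ ((i : Fin r) → ZMod (M i.castSucc)) :=
      e.trans (AddEquiv.piCongrRight fun i => (ZMod.ringEquivCongr (hMc i).symm).toAddEquiv)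
    let e5 : ((i : Fin (r + 1)) → ZMod (M i)) ≃+
        ((i : Fin r) → ZMod (M i.castSucc)) × ZMod (M (Fin.last r)) :=
      { toFun := fun f => (fun i => f i.castSucc, f (Fin.last r))
        invFun := fun p => Fin.snoc (α := fun i => ZMod (M i)) p.1 p.2
        left_inv := fun f => by
          ext i
          induction i using Fin.lastCases <;> simp
        right_inv := fun p => by ext <;> simp
        map_add' := fun _ _ => rfl }
    exact ⟨e1.symm.trans ((e4.prodCongr e3.symm).trans e5.symm)⟩

section Invariants

variable (G : Type*) [AddCommGroup G] [Finite G]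

/-- The rank `rk(G)`: the length `r` of the type `(m₁, …, m_r)` of `G`. (The type is uniquely
determined by `G`, so it does not matter how it is picked.) -/
noncomputable def rk : ℕ := (exists_isOfType G).choose

/-- The invariant factors `m₁ ∣ ⋯ ∣ m_r` of `G`, indexed from `0`. -/
noncomputable def invFactor : Fin (rk G) → ℕ := (exists_isOfType G).choose_spec.choose

theorem isOfType_invFactor : IsOfType G (invFactor G) :=
  (exists_isOfType G).choose_spec.choose_spec

/-- `ν_k(G)`: the number of indices `i` with `mᵢ = k`. -/
noncomputable def nu (k : ℕ) : ℕ := (Finset.univ.filter fun i => invFactor G i = k).card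

variable {G}

/-- The elements `b₁, …, b_r` (indexed from `0`) form a standard generating set of `G`:
`G = ⟨b₁⟩ ⊕ ⋯ ⊕ ⟨b_r⟩` and `ord(bᵢ) = mᵢ`. -/
def IsStandardGenerating (b : Fin (rk G) → G) : Prop :=
  DirectSum.IsInternal (fun i => AddSubgroup.zmultiples (b i)) ∧
    ∀ i, addOrderOf (b i) = invFactor G i

/-- The set `({b₁, …, b_r} ∪ {b_{2i-1} + b_{2i} : 1 ≤ i ≤ ν₃(G)/2})^±`. In zero-based indexing
the pairs `(2i-1, 2i)` become the pairs `(k, k+1)` with `k` even and `k + 2 ≤ ν₃(G)`. -/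
def extremalSet (b : Fin (rk G) → G) : Set G :=
  symmClosure (Set.range b ∪
    {g | ∃ k l : Fin (rk G), Even (k : ℕ) ∧ (l : ℕ) = k + 1 ∧ (k : ℕ) + 2 ≤ nu G 3 ∧
      g = b k + b l})

end Invariants

end FinAbDiam

namespace FinAbDiam

/-! ### Sums of at most `n` elements of `A^±`, and their behaviour under homomorphisms. -/

section Reach

variable {G Q : Type*} [AddCommGroup G] [AddCommGroup Q] {A : Set G}

/-! The diameter of `G` is `halfSum G`, the sum of the `⌊mᵢ / 2⌋`. For the upper bound, factor out a
nonzero `a ∈ A`: multiples of `a` cost at most `⌊ord a / 2⌋` steps, and `halfSum_add_le` says that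
this plus `halfSum (G ⧸ ⟨a⟩)` is at most `halfSum G`, because the invariant factors of `G` and of
the quotient interlace. Induction gives `reach_halfSum`. For the lower bound, the set built from a
standard basis needs that many steps (`IsStandardGenerating.halfSum_le`).

A symmetric generating set `A ∋ 0` of maximal diameter (`Extremal`) leaves no slack in these
inequalities, so no shortcut inside a subgroup generated by elements of `A` is possible. Hence `A ∩
⟨a⟩ = {0, a, -a}`; two elements, neither a multiple of the other, are independent
(`disjoint_zmultiples`); a third element, up to sign, in the span of two such elements forces both
orders to be `3` (`mem_span_pair`); and orders are comparable under divisibility, so that some `a ∈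
A` has order `exp G`.

The bound `Extremal.ncard_le` follows by induction. Factoring out this `a` deletes the largest
invariant factor. Either `A` outside `⟨a⟩` maps injectively, and one only counts `±a`; or `exp G =
3` and `A` contains some `a, b, a + b`. In that case factoring out `⟨a, b⟩` deletes two factors `3`
and accounts for six nonzero elements, two more than a basis would give; this is the origin of `2⌊ν₃
/ 2⌋`.

The standard example attains the bound, so it is maximal under inclusion. It is aperiodic because a
period could be absorbed into a single summand at no cost. -/

theorem mem_symmClosure {x : G} : x ∈ symmClosure A ↔ -x ∈ A ∨ x = 0 ∨ x ∈ A := by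
  simp only [symmClosure, Set.mem_union, Set.mem_neg, Set.mem_singleton_iff, or_assoc]

theorem neg_mem_symmClosure {x : G} (h : x ∈ symmClosure A) : -x ∈ symmClosure A := by
  rw [mem_symmClosure] at *
  rw [neg_neg, neg_eq_zero]; tauto

theorem subset_symmClosure : A ⊆ symmClosure A := fun _ h => mem_symmClosure.2 (Or.inr (Or.inr h))

theorem zero_mem_symmClosure : (0 : G) ∈ symmClosure A := mem_symmClosure.2 (by simp)

theorem symmClosure_eq_self (h0 : (0 : G) ∈ A) (hn : ∀ x ∈ A, -x ∈ A) : symmClosure A = A := by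
  refine subset_antisymm (fun x hx => ?_) subset_symmClosure
  rcases mem_symmClosure.1 hx with h | h | h
  · simpa using hn _ h
  · exact h ▸ h0
  · exact h

theorem symmClosure_symmClosure : symmClosure (symmClosure A) = symmClosure A :=
  symmClosure_eq_self zero_mem_symmClosure fun _ => neg_mem_symmClosure

theorem reach_symmClosure (n : ℕ) : reach (symmClosure A) n = reach A n := by
  simp only [reach, symmClosure_symmClosure]

theorem image_symmClosure (φ : G →+ Q) : φ '' symmClosure A = symmClosure (φ '' A) := by
  ext y
  simp only [Set.mem_image, mem_symmClosure]
  constructor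
  · rintro ⟨x, h | h | h, rfl⟩
    · exact Or.inl ⟨_, h, by simp⟩
    · simp [h]
    · exact Or.inr (Or.inr ⟨_, h, rfl⟩)
  · rintro (⟨x, h, hx⟩ | h | ⟨x, h, rfl⟩)
    · exact ⟨-x, by simp [h], by simp [hx]⟩
    · exact ⟨0, by simp, by simp [h]⟩
    · exact ⟨x, by simp [h], rfl⟩

theorem zero_mem_reach (n : ℕ) : (0 : G) ∈ reach A n :=
  ⟨fun _ => 0, fun _ => zero_mem_symmClosure, by simp⟩

theorem mem_reach_one {x : G} : x ∈ reach A 1 ↔ x ∈ symmClosure A := by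
  constructor
  · rintro ⟨a, ha, rfl⟩
    simpa using ha 0
  · intro h
    exact ⟨fun _ => x, fun _ => h, by simp⟩

theorem add_mem_reach {m n : ℕ} {x y : G} (hx : x ∈ reach A m) (hy : y ∈ reach A n) :
    x + y ∈ reach A (m + n) := by
  obtain ⟨a, ha, rfl⟩ := hx
  obtain ⟨b, hb, rfl⟩ := hy
  refine ⟨Fin.append a b, fun i => ?_, by simp [Fin.sum_univ_add]⟩
  induction i using Fin.addCases with
  | left i => simpa using ha i
  | right i => simpa using hb i

theorem reach_mono {m n : ℕ} (h : m ≤ n) : reach A m ⊆ reach A n := by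
  intro x hx
  obtain ⟨k, rfl⟩ := Nat.exists_eq_add_of_le h
  simpa using add_mem_reach hx (zero_mem_reach k)

theorem neg_mem_reach {n : ℕ} {x : G} (hx : x ∈ reach A n) : -x ∈ reach A n := by
  obtain ⟨a, ha, rfl⟩ := hx
  exact ⟨fun i => -a i, fun i => neg_mem_symmClosure (ha i), by simp⟩

theorem reach_succ_exists {n : ℕ} {x : G} (hx : x ∈ reach A (n + 1)) :
    ∃ s ∈ symmClosure A, ∃ y ∈ reach A n, x = s + y := by
  obtain ⟨a, ha, rfl⟩ := hx
  exact ⟨a 0, ha 0, _, ⟨fun i => a i.succ, fun i => ha _, rfl⟩, Fin.sum_univ_succ a⟩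

theorem mem_reach_of_mem {x : G} (hx : x ∈ A) : x ∈ reach A 1 :=
  mem_reach_one.2 (subset_symmClosure hx)

theorem nsmul_mem_reach {a : G} (ha : a ∈ A) (n : ℕ) : n • a ∈ reach A n :=
  ⟨fun _ => a, fun _ => subset_symmClosure ha, by simp⟩

theorem zsmul_mem_reach {a : G} (ha : a ∈ A) (k : ℤ) : k • a ∈ reach A k.natAbs := by
  rcases Int.natAbs_eq k with h | h
  · rw [h, natCast_zsmul]; exact nsmul_mem_reach ha _
  · rw [h, neg_smul, natCast_zsmul, Int.natAbs_neg]; exact neg_mem_reach (nsmul_mem_reach ha _)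

theorem zsmul_mem_reach_of_le {a : G} (ha : a ∈ A) {k : ℤ} {n : ℕ} (h : k.natAbs ≤ n) :
    k • a ∈ reach A n := reach_mono h (zsmul_mem_reach ha k)

theorem exists_lift_mem_reach (φ : G →+ Q) {n : ℕ} {y : Q} (hy : y ∈ reach (φ '' A) n) :
    ∃ x ∈ reach A n, φ x = y := by
  obtain ⟨a, ha, rfl⟩ := hy
  simp only [← image_symmClosure] at ha
  choose c hc hca using ha
  exact ⟨_, ⟨c, hc, rfl⟩, by simp [hca]⟩

/-- If the kernel of a homomorphism is covered in `n` steps and its image in `k` steps, then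
`n + k` steps suffice. -/
theorem reach_eq_univ_of_ker (φ : G →+ Q) {n k : ℕ} (hk : ∀ x, φ x = 0 → x ∈ reach A n)
    (hq : reach (φ '' A) k = Set.univ) : reach A (n + k) = Set.univ := by
  refine Set.eq_univ_of_forall fun x => ?_
  obtain ⟨y, hy, hxy⟩ := exists_lift_mem_reach φ (hq ▸ Set.mem_univ (φ x) : φ x ∈ reach (φ '' A) k)
  have := add_mem_reach (hk (x - y) (by simp [hxy])) hy
  simpa using this

theorem reach_subset_closure (n : ℕ) : reach A n ⊆ AddSubgroup.closure A := by
  rintro x ⟨a, ha, rfl⟩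
  refine sum_mem fun i _ => ?_
  rcases mem_symmClosure.1 (ha i) with h | h | h
  · exact neg_mem_iff.1 (AddSubgroup.subset_closure h)
  · rw [h]; exact zero_mem _
  · exact AddSubgroup.subset_closure h

theorem closure_eq_top_of_reach {n : ℕ} (h : reach A n = Set.univ) : AddSubgroup.closure A = ⊤ := by
  rw [eq_top_iff]
  intro x _
  exact reach_subset_closure n (h ▸ Set.mem_univ x)

theorem le_diamWith_iff {ρ : ℕ} :
    (ρ : ℕ∞) ≤ diamWith A ↔ ∀ n, reach A n = Set.univ → ρ ≤ n := by
  rw [diamWith, le_sInf_iff]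
  constructor
  · intro h n hn
    exact_mod_cast h n ⟨n, rfl, hn⟩
  · rintro h _ ⟨n, rfl, hn⟩
    exact_mod_cast h n hn

theorem diamWith_le {n : ℕ} (h : reach A n = Set.univ) : diamWith A ≤ n :=
  sInf_le ⟨n, rfl, h⟩

theorem exists_reach_of_diamWith_lt_top (h : diamWith A < ⊤) : ∃ n, reach A n = Set.univ := by
  obtain ⟨_, ⟨n, -, hn⟩, -⟩ := sInf_lt_iff.1 h
  exact ⟨n, hn⟩

/-- A multiple of `a` is `k • a` with `|k|` at most half the order of `a`. -/
theorem exists_zsmul_eq_natAbs_le [Finite G] {a x : G} (hx : x ∈ AddSubgroup.zmultiples a) :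
    ∃ k : ℤ, x = k • a ∧ k.natAbs ≤ addOrderOf a / 2 := by
  obtain ⟨k, rfl⟩ := hx
  have hpos : 0 < addOrderOf a := addOrderOf_pos a
  refine ⟨Int.bmod k (addOrderOf a), ?_, ?_⟩
  · have h : ((addOrderOf a : ℕ) : ℤ) ∣ k - Int.bmod k (addOrderOf a) := by
      exact Int.dvd_self_sub_bmod
    have := addOrderOf_dvd_iff_zsmul_eq_zero.1 h
    rw [sub_smul, sub_eq_zero] at this
    exact this
  · have h1 := Int.le_bmod (x := k) hpos
    have h2 := Int.bmod_lt (x := k) hpos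
    omega

theorem zmultiples_subset_reach [Finite G] {a x : G} (ha : a ∈ A)
    (hx : x ∈ AddSubgroup.zmultiples a) : x ∈ reach A (addOrderOf a / 2) := by
  obtain ⟨k, rfl, hk⟩ := exists_zsmul_eq_natAbs_le hx
  exact zsmul_mem_reach_of_le ha hk

end Reach

/-! ### Interlacing of invariant factors under cyclic quotients. -/

section InvariantFactors

theorem card_eq_of_ker {G Q : Type*} [AddCommGroup G] [AddCommGroup Q] (φ : G →+ Q)
    (hφ : Function.Surjective φ) {a : G}
    (ha : ∀ x, φ x = 0 ↔ x ∈ AddSubgroup.zmultiples a) :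
    Nat.card G = addOrderOf a * Nat.card Q := by
  have h : φ.ker = AddSubgroup.zmultiples a := by
    ext x; rw [AddMonoidHom.mem_ker, ha]
  rw [AddSubgroup.card_eq_card_quotient_mul_card_addSubgroup φ.ker,
    Nat.card_congr (QuotientAddGroup.quotientKerEquivOfSurjective φ hφ).toEquiv, h,
    Nat.card_zmultiples, mul_comm]

variable (G : Type*) [AddCommGroup G] [Finite G]

/-- The invariant factors in decreasing order, continued by `1` beyond the rank. -/
noncomputable def invSeq (i : ℕ) : ℕ :=
  if h : i < rk G then invFactor G ⟨rk G - 1 - i, by omega⟩ else 1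

theorem invSeq_eq_one {i : ℕ} (h : rk G ≤ i) : invSeq G i = 1 := by
  rw [invSeq, dif_neg (by omega)]

theorem one_lt_invSeq {i : ℕ} (h : i < rk G) : 1 < invSeq G i := by
  rw [invSeq, dif_pos h]
  exact (isOfType_invFactor G).1 _

theorem invSeq_pos (i : ℕ) : 0 < invSeq G i := by
  rcases lt_or_ge i (rk G) with h | h
  · exact (zero_lt_one.trans (one_lt_invSeq G h))
  · rw [invSeq_eq_one G h]; exact one_pos

theorem invSeq_dvd {i j : ℕ} (h : i ≤ j) : invSeq G j ∣ invSeq G i := by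
  rcases lt_or_ge j (rk G) with hj | hj
  · rw [invSeq, dif_pos hj, invSeq, dif_pos (by omega)]
    exact (isOfType_invFactor G).2.1 _ _ (by simp; omega)
  · rw [invSeq_eq_one G hj]; exact one_dvd _

theorem invSeq_rev (i : Fin (rk G)) : invSeq G i.rev = invFactor G i := by
  rw [invSeq, dif_pos i.rev.2]
  congr 1
  ext
  simp [Fin.val_rev]; omega

theorem nonempty_equiv_invSeq : Nonempty (G ≃+ ((i : Fin (rk G)) → ZMod (invSeq G i))) := by
  obtain ⟨e⟩ := (isOfType_invFactor G).2.2
  let e1 : ((i : Fin (rk G)) → ZMod (invFactor G i)) ≃+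
      ((i : Fin (rk G)) → ZMod (invSeq G i.rev)) :=
    AddEquiv.piCongrRight fun i => (ZMod.ringEquivCongr (invSeq_rev G i).symm).toAddEquiv
  let e2 : ((i : Fin (rk G)) → ZMod (invSeq G i)) ≃+
      ((i : Fin (rk G)) → ZMod (invSeq G i.rev)) :=
    { toFun := fun f i => f i.rev
      -- `i.rev.rev = i` holds only propositionally, so the value is transported between the two
      -- copies of `ZMod`.
      invFun := fun f i => (ZMod.ringEquivCongr (by rw [Fin.rev_rev])) (f i.rev)
      left_inv := fun f => by
        ext i
        obtain ⟨j, rfl⟩ : ∃ j : Fin (rk G), j.rev = i := ⟨i.rev, Fin.rev_rev i⟩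
        have : ∀ (k : Fin (rk G)) (h : k = j.rev) (h' : invSeq G k = invSeq G j.rev),
            ZMod.ringEquivCongr h' (f k) = f j.rev := by
          rintro k rfl h'
          simp
        exact this _ (by simp) _
      right_inv := fun f => by
        ext i
        have : ∀ (k : Fin (rk G)) (h : k = i) (h' : invSeq G k.rev = invSeq G i.rev),
            ZMod.ringEquivCongr h' (f k) = f i := by
          rintro k rfl h'
          simp
        exact this _ (by simp) _
      map_add' := fun _ _ => rfl }
  exact ⟨(e.trans e1).trans e2.symm⟩

theorem prod_invSeq {R : ℕ} (hR : rk G ≤ R) : ∏ i ∈ Finset.range R, invSeq G i = Nat.card G := by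
  obtain ⟨e⟩ := nonempty_equiv_invSeq G
  rw [Nat.card_congr e.toEquiv, Nat.card_pi, ← Finset.prod_range_mul_prod_Ico _ hR,
    Finset.prod_eq_one (s := Finset.Ico _ _)
      (fun i hi => invSeq_eq_one G (Finset.mem_Ico.1 hi).1), mul_one, Finset.prod_range]
  simp

variable {G}

theorem invSeq_zero_nsmul (x : G) : invSeq G 0 • x = 0 := by
  obtain ⟨e⟩ := nonempty_equiv_invSeq G
  apply e.injective
  ext i
  rw [map_nsmul, map_zero, Pi.smul_apply, Pi.zero_apply, nsmul_eq_mul]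
  rw [(ZMod.natCast_eq_zero_iff _ _).2 (invSeq_dvd G (Nat.zero_le i)), zero_mul]

/-- The subgroup `k G` is generated by `i` elements. -/
def SmulGen (G : Type*) [AddCommGroup G] (k i : ℕ) : Prop :=
  ∃ y : Fin i → G, ∀ x : G, ∃ z : Fin i → ℤ, k • x = ∑ t, z t • k • y t

theorem SmulGen.map {G Q : Type*} [AddCommGroup G] [AddCommGroup Q] {k i : ℕ} (h : SmulGen G k i)
    (φ : G →+ Q) (hφ : Function.Surjective φ) : SmulGen Q k i := by
  obtain ⟨y, hy⟩ := h
  refine ⟨fun t => φ (y t), fun x => ?_⟩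
  obtain ⟨x, rfl⟩ := hφ x
  obtain ⟨z, hz⟩ := hy x
  exact ⟨z, by rw [← map_nsmul, hz]; simp⟩

/-- The kernel of `k G → k Q` lies in `⟨a⟩`, hence is cyclic, and one generator of it completes
lifts of the generators of `k Q`. -/
theorem SmulGen.of_cyclic_ker {G Q : Type*} [AddCommGroup G] [AddCommGroup Q] {k i : ℕ}
    (h : SmulGen Q k i) (φ : G →+ Q) (hφ : Function.Surjective φ) {a : G}
    (ha : ∀ x, φ x = 0 → x ∈ AddSubgroup.zmultiples a) : SmulGen G k (i + 1) := by
  obtain ⟨y, hy⟩ := h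
  choose y' hy' using fun t => hφ (y t)
  -- the multiples of `a` in `k G` form a cyclic group
  let K : AddSubgroup ℤ := ((nsmulAddMonoidHom (α := G) k).range).comap (zmultiplesHom G a)
  obtain ⟨c, hc⟩ := Int.subgroup_cyclic K
  have hcK : c ∈ K := by rw [hc]; exact AddSubgroup.subset_closure rfl
  obtain ⟨y₀, hy₀⟩ : ∃ y₀, k • y₀ = c • a := by
    obtain ⟨w, hw⟩ := hcK
    exact ⟨w, hw⟩
  refine ⟨Fin.snoc (α := fun _ => G) y' y₀, fun x => ?_⟩
  obtain ⟨z, hz⟩ := hy (φ x)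
  obtain ⟨m, hm⟩ := ha (k • x - ∑ t, z t • k • y' t) (by simp [hz, hy'])
  have hmK : m ∈ K := by
    refine ⟨x - ∑ t, z t • y' t, ?_⟩
    have : ∀ t, z t • k • y' t = k • z t • y' t := fun t => smul_comm _ _ _
    simp only [zmultiplesHom_apply]
    simp only at hm
    rw [hm]
    simp [smul_sub, Finset.smul_sum, this]
  rw [hc, ← AddSubgroup.zmultiples_eq_closure] at hmK
  obtain ⟨l, rfl⟩ := hmK
  refine ⟨Fin.snoc (α := fun _ => ℤ) z l, ?_⟩
  rw [Fin.sum_univ_castSucc]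
  simp only [Fin.snoc_castSucc, Fin.snoc_last, hy₀]
  simp only [smul_eq_mul, mul_smul] at hm
  rw [hm]; abel

/-- With `M' = M / gcd(k, M) > 1`, the group `k (ℤ/M)^(i+1)` has at least `M'^(i+1)` elements, while
`i` generators of exponent dividing `M'` yield at most `M'^i`. -/
theorem not_smulGen_pi {M k i : ℕ} (hM : 0 < M) (hk : ¬ M ∣ k) :
    ¬ SmulGen (Fin (i + 1) → ZMod M) k i := by
  rintro ⟨y, hy⟩
  set M' := M / Nat.gcd k M with hM'
  have hg : 0 < Nat.gcd k M := Nat.gcd_pos_of_pos_right _ hM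
  have hMM : M' * Nat.gcd k M = M := Nat.div_mul_cancel (Nat.gcd_dvd_right _ _)
  have hM'1 : 1 < M' := by
    rcases Nat.lt_or_ge 1 M' with h | h
    · exact h
    · exfalso
      apply hk
      have : M' ≤ 1 := h
      interval_cases hh : M'
      · omega
      · rw [one_mul] at hMM
        rw [← hMM]; exact Nat.gcd_dvd_left _ _
  have hcop : Nat.Coprime M' (k / Nat.gcd k M) := (Nat.coprime_div_gcd_div_gcd hg).symm
  have hkk : (k / Nat.gcd k M) * Nat.gcd k M = k := Nat.div_mul_cancel (Nat.gcd_dvd_left _ _)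
  -- `k z = 0` modulo `M` if and only if `M' ∣ z`
  have key : ∀ z : ℤ, (M : ℤ) ∣ k * z ↔ (M' : ℤ) ∣ z := by
    intro z
    have e1 : (M : ℤ) = Nat.gcd k M * M' := by rw [mul_comm]; exact_mod_cast hMM.symm
    have e2 : (k : ℤ) * z = Nat.gcd k M * ((k / Nat.gcd k M : ℕ) * z) := by
      rw [← mul_assoc, mul_comm (Nat.gcd k M : ℤ)]
      congr 1
      exact_mod_cast hkk.symm
    rw [e2]
    conv_lhs => rw [e1]
    rw [mul_dvd_mul_iff_left (by exact_mod_cast hg.ne')]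
    exact ⟨fun h => IsCoprime.dvd_of_dvd_mul_left (Nat.isCoprime_iff_coprime.2 hcop) h, fun h => h.mul_left _⟩
  have hz : ∀ u : Fin (i + 1) → Fin M', ∃ z : Fin i → Fin M',
      k • (fun j => ((u j : ℕ) : ZMod M)) = ∑ t, ((z t : ℕ) : ℤ) • k • y t := by
    intro u
    obtain ⟨z, hz⟩ := hy fun j => ((u j : ℕ) : ZMod M)
    have hpos : (0 : ℤ) < M' := by omega
    have hnn : ∀ t, 0 ≤ z t % M' := fun t => Int.emod_nonneg _ hpos.ne'
    refine ⟨fun t => ⟨(z t % M').toNat, by have := Int.emod_lt_of_pos (z t) hpos; have := hnn t; omega⟩, ?_⟩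
    rw [hz]
    refine Finset.sum_congr rfl fun t _ => ?_
    ext j
    simp only [Int.toNat_of_nonneg (hnn t)]
    rw [← sub_eq_zero, ← Pi.sub_apply, ← sub_smul]
    have hd : (M : ℤ) ∣ k * (z t - z t % M') := (key _).2 (Int.dvd_self_sub_emod)
    simp only [Pi.smul_apply, zsmul_eq_mul, nsmul_eq_mul]
    have := (ZMod.intCast_zmod_eq_zero_iff_dvd _ _).2 hd
    rw [Pi.mul_apply, ← mul_assoc, mul_comm _ ((k : Fin (i + 1) → ZMod M) j), Pi.natCast_apply]
    have e : ((k : ZMod M) * ((z t - z t % (M' : ℤ) : ℤ) : ZMod M)) = 0 := by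
      rw [← this]; push_cast; rfl
    rw [e, zero_mul]
  choose ζ hζ using hz
  have hinj : Function.Injective ζ := by
    intro u v huv
    have h1 := (hζ u).trans ((by rw [huv] : _ = _).trans (hζ v).symm)
    ext j
    have h2 := congrFun h1 j
    simp only [Pi.smul_apply, nsmul_eq_mul] at h2
    have h3 : (M : ℤ) ∣ k * (((u j : ℕ) : ℤ) - (v j : ℕ)) := by
      rw [← ZMod.intCast_zmod_eq_zero_iff_dvd]
      push_cast
      rw [mul_sub, sub_eq_zero]
      exact h2
    have h4 := Int.eq_zero_of_abs_lt_dvd ((key _).1 h3) (by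
      have := (u j).2; have := (v j).2
      rw [abs_lt]; constructor <;> omega)
    omega
  have hcard := Fintype.card_le_of_injective ζ hinj
  simp only [Fintype.card_fun, Fintype.card_fin] at hcard
  have := Nat.pow_lt_pow_right hM'1 (Nat.lt_add_one i)
  omega

/-- This describes the invariant factors intrinsically, which makes them comparable between a group
and its quotients. If divisibility fails, `G` maps onto `(ℤ/M)^(i+1)` with `M = invSeq G i`; if it
holds, `k` kills all cyclic factors except the first `i`. -/
theorem smulGen_iff {k i : ℕ} : SmulGen G k i ↔ invSeq G i ∣ k := by
  obtain ⟨e⟩ := nonempty_equiv_invSeq G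
  constructor
  · intro h
    rcases le_or_gt (rk G) i with hi | hi
    · rw [invSeq_eq_one G hi]; exact one_dvd _
    · by_contra hk
      let ψ : ((j : Fin (rk G)) → ZMod (invSeq G j)) →+ (Fin (i + 1) → ZMod (invSeq G i)) :=
        { toFun := fun f t => ZMod.castHom
            (invSeq_dvd G (Nat.lt_succ_iff.1 t.2) : invSeq G i ∣ invSeq G t) _
            (f ⟨t, by omega⟩)
          map_zero' := by ext; simp
          map_add' := fun f g => by ext; exact map_add (ZMod.castHom _ _) _ _ }
      have hψ : Function.Surjective ψ := by
        intro w
        choose w' hw' using fun t : Fin (i + 1) => ZMod.ringHom_surjective (ZMod.castHom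
            (invSeq_dvd G (Nat.lt_succ_iff.1 t.2) : invSeq G i ∣ invSeq G t)
              (ZMod (invSeq G i))) (w t)
        refine ⟨fun j => if h : (j : ℕ) < i + 1 then w' ⟨j, h⟩ else 0, ?_⟩
        ext t
        have hd : invSeq G i ∣ invSeq G t := invSeq_dvd G (Nat.lt_succ_iff.1 t.2)
        change ZMod.castHom hd (ZMod (invSeq G i)) (dite _ _ _) = _
        rw [dif_pos t.2]
        exact hw' t
      exact not_smulGen_pi (invSeq_pos G i) hk
        (h.map (ψ.comp e.toAddMonoidHom) (hψ.comp e.surjective))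
  · intro hk
    suffices h : SmulGen ((j : Fin (rk G)) → ZMod (invSeq G j)) k i from
      h.map e.symm.toAddMonoidHom e.symm.surjective
    refine ⟨fun t => if h : (t : ℕ) < rk G then Pi.single ⟨t, h⟩ 1 else 0, fun x => ?_⟩
    refine ⟨fun t => if h : (t : ℕ) < rk G then (x ⟨t, h⟩).val else 0, ?_⟩
    ext j
    have : NeZero (invSeq G j) := ⟨(invSeq_pos G j).ne'⟩
    rw [Finset.sum_apply]
    rcases lt_or_ge (j : ℕ) i with hj | hj
    · rw [Finset.sum_eq_single ⟨j, hj⟩]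
      · simp [mul_comm]
      · intro t _ htj
        have htj' : (t : ℕ) ≠ j := fun h => htj (Fin.ext h)
        by_cases ht : (t : ℕ) < rk G
        · have : j ≠ ⟨t, ht⟩ := fun h => htj' (congrArg Fin.val h).symm
          simp [ht, this]
        · simp [ht]
      · simp
    · rw [Finset.sum_eq_zero]
      · have h0 : ((k : ℕ) : ZMod (invSeq G j)) = 0 :=
          (ZMod.natCast_eq_zero_iff _ _).2 ((invSeq_dvd G hj).trans hk)
        simp [h0]
      · intro t _
        have htj' : (t : ℕ) ≠ j := by omega
        by_cases ht : (t : ℕ) < rk G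
        · have : j ≠ ⟨t, ht⟩ := fun h => htj' (congrArg Fin.val h).symm
          simp [ht, this]
        · simp [ht]

variable {Q : Type*} [AddCommGroup Q] [Finite Q]

theorem invSeq_dvd_of_surjective (φ : G →+ Q) (hφ : Function.Surjective φ) (i : ℕ) :
    invSeq Q i ∣ invSeq G i :=
  smulGen_iff.1 ((smulGen_iff.2 (dvd_refl (invSeq G i))).map φ hφ)

/-- Together with `invSeq_dvd_of_surjective` this is the interlacing of the two sequences. -/
theorem invSeq_succ_dvd_of_surjective (φ : G →+ Q) (hφ : Function.Surjective φ) {a : G}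
    (ha : ∀ x, φ x = 0 → x ∈ AddSubgroup.zmultiples a) (i : ℕ) :
    invSeq G (i + 1) ∣ invSeq Q i :=
  smulGen_iff.1 ((smulGen_iff.2 (dvd_refl (invSeq Q i))).of_cyclic_ker φ hφ ha)

theorem rk_le_of_surjective (φ : G →+ Q) (hφ : Function.Surjective φ) : rk Q ≤ rk G := by
  by_contra h
  have h1 := one_lt_invSeq Q (not_le.1 h)
  have h2 := invSeq_dvd_of_surjective φ hφ (rk G)
  rw [invSeq_eq_one G le_rfl, Nat.dvd_one] at h2
  omega

/-! ### The inequality behind the diameter bound. -/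

variable (G) in
/-- The sum of the `⌊mᵢ / 2⌋` over the invariant factors. -/
noncomputable def halfSum : ℕ := ∑ i ∈ Finset.range (rk G), invSeq G i / 2

theorem halfSum_eq {R : ℕ} (hR : rk G ≤ R) :
    halfSum G = ∑ i ∈ Finset.range R, invSeq G i / 2 := by
  rw [halfSum, ← Finset.sum_range_add_sum_Ico _ hR, Finset.sum_eq_zero (s := Finset.Ico _ _)]
  · simp
  · intro i hi
    rw [invSeq_eq_one G (Finset.mem_Ico.1 hi).1]; rfl

/-- With `N = d c`, the difference of the two sides before halving and rounding is `d (c - 1) (l -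
1) ≥ 0`. -/
theorem half_add_half_le {N d l : ℕ} (hd : d ∣ N) (hN : 0 < N) (hl : 0 < l) :
    N / 2 + d * l / 2 ≤ N * l / 2 + d / 2 := by
  obtain ⟨c, rfl⟩ := hd
  have hc : 0 < c := Nat.pos_of_ne_zero (by rintro rfl; simp at hN)
  have hd : 0 < d := Nat.pos_of_ne_zero (by rintro rfl; simp at hN)
  have key : (c - 1 : ℤ) * (l - 1) * d ≥ 0 := by
    have : (1 : ℤ) ≤ c := by exact_mod_cast hc
    have : (1 : ℤ) ≤ l := by exact_mod_cast hl
    have : (0 : ℤ) ≤ (c - 1 : ℤ) * (l - 1) := mul_nonneg (by linarith) (by linarith)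
    positivity
  have e : (c - 1 : ℤ) * (l - 1) * d = d * c * l + d - d * c - d * l := by ring
  rw [e] at key
  have key' : d * c + d * l ≤ d * c * l + d := by zify; linarith
  by_cases h : d * c + d * l + 2 ≤ d * c * l + d
  · omega
  · -- the floors can only matter when `(c - 1) (l - 1) d ≤ 1`
    rcases Nat.lt_or_ge 1 c with h1 | h1
    · rcases Nat.lt_or_ge 1 l with h2 | h2
      · have hc2 : c = 2 := by
          by_contra hc2
          apply h
          have : 3 ≤ c := by omega
          zify at *
          nlinarith [mul_pos (show (0:ℤ) < d by linarith) (show (0:ℤ) < l - 1 by linarith),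
            mul_nonneg (mul_nonneg (show (0:ℤ) ≤ d by linarith) (show (0:ℤ) ≤ l - 2 by linarith))
              (show (0:ℤ) ≤ c - 3 by linarith), mul_nonneg (show (0:ℤ) ≤ d by linarith)
              (show (0:ℤ) ≤ l - 2 by linarith), mul_nonneg (show (0:ℤ) ≤ d by linarith)
              (show (0:ℤ) ≤ c - 3 by linarith)]
        subst hc2
        have : d * 2 * l = 2 * (d * l) := by ring
        rw [this] at *
        have : d * l ≥ d * 2 := Nat.mul_le_mul_left _ h2
        omega
      · have : l = 1 := by omega
        subst this
        simp
    · have : c = 1 := by omega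
      subst this
      simp; omega

/-- Induction that peels off the largest factors. If `d'` is the quotient of the products of the
tails, then `d = d' l` with `l = M 0 / N 0`, and `half_add_half_le` moves `l` from `d` to `N 0`. It
requires `d' ∣ N 0`, which is why the divisibility is carried along in the conclusion. -/
theorem sum_half_add_le {R : ℕ} : ∀ {M N : ℕ → ℕ} {d : ℕ}, (∀ i, 0 < M i) → (∀ i, N i ∣ M i) →
    (∀ i, M (i + 1) ∣ N i) → M R = 1 →
    ∏ i ∈ Finset.range R, M i = d * ∏ i ∈ Finset.range R, N i →
    d ∣ M 0 ∧ ∑ i ∈ Finset.range R, N i / 2 + d / 2 ≤ ∑ i ∈ Finset.range R, M i / 2 := by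
  induction R with
  | zero =>
    intro M N d _ _ _ _ h
    simp only [Finset.range_zero, Finset.prod_empty, mul_one] at h
    subst h
    simp
  | succ R ih =>
    intro M N d hpos h1 h2 hR h
    have hNpos : ∀ i, 0 < N i := fun i => Nat.pos_of_dvd_of_pos (h1 i) (hpos i)
    obtain ⟨l, hl⟩ := h1 0
    have hl0 : 0 < l := Nat.pos_of_ne_zero (by rintro rfl; have := hpos 0; simp_all)
    have hprod : ∏ i ∈ Finset.range R, N (i + 1) ∣ ∏ i ∈ Finset.range R, M (i + 1) :=
      Finset.prod_dvd_prod_of_dvd _ _ fun i _ => h1 _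
    obtain ⟨d', hd'⟩ := hprod
    rw [mul_comm] at hd'
    obtain ⟨h3, h4⟩ := ih (fun i => hpos (i + 1)) (fun i => h1 (i + 1)) (fun i => h2 (i + 1)) hR hd'
    rw [Finset.prod_range_succ', Finset.prod_range_succ', hd', hl] at h
    have hPpos : 0 < (∏ i ∈ Finset.range R, N (i + 1)) * N 0 :=
      Nat.mul_pos (Finset.prod_pos fun i _ => hNpos _) (hNpos 0)
    have hd : d = d' * l := by
      apply Nat.eq_of_mul_eq_mul_right hPpos
      rw [← h]; ring
    have hd0 : d' ∣ N 0 := h3.trans (h2 0)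
    refine ⟨by rw [hl, hd]; exact mul_dvd_mul_right hd0 l, ?_⟩
    rw [Finset.sum_range_succ', Finset.sum_range_succ']
    have := half_add_half_le hd0 (hNpos 0) hl0
    rw [hd, hl]
    omega

theorem halfSum_add_le (φ : G →+ Q) (hφ : Function.Surjective φ) {a : G}
    (ha : ∀ x, φ x = 0 ↔ x ∈ AddSubgroup.zmultiples a) :
    addOrderOf a / 2 + halfSum Q ≤ halfSum G := by
  have hr := rk_le_of_surjective φ hφ
  rw [halfSum_eq (G := Q) hr, halfSum, add_comm]
  refine (sum_half_add_le (invSeq_pos G) (invSeq_dvd_of_surjective φ hφ)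
    (invSeq_succ_dvd_of_surjective φ hφ fun x => (ha x).1) (invSeq_eq_one G le_rfl) ?_).2
  rw [prod_invSeq G le_rfl, prod_invSeq Q hr, card_eq_of_ker φ hφ ha]

/-- Factoring out an element of maximal order removes the largest invariant factor. -/
theorem invSeq_of_addOrderOf_eq (φ : G →+ Q) (hφ : Function.Surjective φ) {a : G}
    (ha : ∀ x, φ x = 0 ↔ x ∈ AddSubgroup.zmultiples a) (hord : addOrderOf a = invSeq G 0) (i : ℕ) :
    invSeq Q i = invSeq G (i + 1) := by
  have hr := rk_le_of_surjective φ hφ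
  have hd := invSeq_succ_dvd_of_surjective φ hφ fun x => (ha x).1
  have hcard := card_eq_of_ker φ hφ ha
  -- Long enough for the truncated products to be group orders and for the index `i` to take part in
  -- them.
  set R := rk G + i + 1 with hR
  have hp : ∏ j ∈ Finset.range R, invSeq G (j + 1) = ∏ j ∈ Finset.range R, invSeq Q j := by
    rw [← prod_invSeq G (R := R + 1) (by omega), Finset.prod_range_succ', hord,
      ← prod_invSeq Q (R := R) (by omega), mul_comm] at hcard
    exact Nat.eq_of_mul_eq_mul_left (invSeq_pos G 0) hcard
  by_contra hne
  have hlt : invSeq G (i + 1) < invSeq Q i :=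
    lt_of_le_of_ne (Nat.le_of_dvd (invSeq_pos Q i) (hd i)) (Ne.symm hne)
  refine absurd hp (ne_of_lt ?_)
  exact Finset.prod_lt_prod (fun j _ => invSeq_pos G _)
    (fun j _ => Nat.le_of_dvd (invSeq_pos Q j) (hd j)) ⟨i, by simp; omega, hlt⟩

end InvariantFactors

/-! ### Generating sets of maximal diameter. -/

section Extremal

theorem closure_image_eq_top {G Q : Type*} [AddCommGroup G] [AddCommGroup Q] {A : Set G}
    (hA : AddSubgroup.closure A = ⊤) (φ : G →+ Q) (hφ : Function.Surjective φ) :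
    AddSubgroup.closure (φ '' A) = ⊤ := by
  rw [← AddMonoidHom.map_closure, hA, AddSubgroup.map_top_of_surjective φ hφ]

theorem mk_zmultiples_eq_zero_iff {G : Type*} [AddCommGroup G] (a x : G) :
    QuotientAddGroup.mk' (AddSubgroup.zmultiples a) x = 0 ↔ x ∈ AddSubgroup.zmultiples a :=
  QuotientAddGroup.eq_zero_iff x

theorem card_quotient_zmultiples_lt {G : Type*} [AddCommGroup G] [Finite G] {a : G} (ha : a ≠ 0) :
    Nat.card (G ⧸ AddSubgroup.zmultiples a) < Nat.card G := by
  rw [card_eq_of_ker (QuotientAddGroup.mk' (AddSubgroup.zmultiples a))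
    (QuotientAddGroup.mk'_surjective _) (mk_zmultiples_eq_zero_iff a)]
  have h1 : addOrderOf a ≠ 1 := fun h => ha (AddMonoid.addOrderOf_eq_one_iff.1 h)
  have h2 := addOrderOf_pos a
  have h3 : 0 < Nat.card (G ⧸ AddSubgroup.zmultiples a) := Nat.card_pos
  nlinarith [show 2 ≤ addOrderOf a by omega]

/-- The diameter with respect to any generating set is at most the sum of the `⌊mᵢ / 2⌋`. -/
theorem reach_halfSum {G : Type*} [AddCommGroup G] [Finite G] {A : Set G}
    (hA : AddSubgroup.closure A = ⊤) : reach A (halfSum G) = Set.univ := by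
  induction hc : Nat.card G using Nat.strong_induction_on generalizing G with
  | _ c ih =>
  by_cases h : ∃ a ∈ A, a ≠ 0
  · obtain ⟨a, haA, ha0⟩ := h
    set φ := QuotientAddGroup.mk' (AddSubgroup.zmultiples a)
    have hφ : Function.Surjective φ := QuotientAddGroup.mk'_surjective _
    have hker := mk_zmultiples_eq_zero_iff a
    have h1 := ih _ (hc ▸ card_quotient_zmultiples_lt ha0) (closure_image_eq_top hA φ hφ) rfl
    have h2 := reach_eq_univ_of_ker φ (n := addOrderOf a / 2)
      (fun x hx => zmultiples_subset_reach haA ((hker x).1 hx)) h1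
    refine Set.eq_univ_of_univ_subset ?_
    rw [← h2]
    exact reach_mono (halfSum_add_le φ hφ hker)
  · push Not at h
    have h1 : AddSubgroup.closure A ≤ ⊥ := by
      rw [AddSubgroup.closure_le]
      intro a ha
      exact h a ha
    rw [hA] at h1
    refine Set.eq_univ_of_forall fun x => ?_
    have : x = 0 := h1 (AddSubgroup.mem_top x)
    rw [this]
    exact zero_mem_reach _

/-- A symmetric generating set containing `0` whose diameter is as large as possible. -/
structure Extremal {G : Type*} [AddCommGroup G] [Finite G] (A : Set G) : Prop where
  closure_eq : AddSubgroup.closure A = ⊤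
  zero_mem : (0 : G) ∈ A
  neg_mem : ∀ x ∈ A, -x ∈ A
  le : ∀ n, reach A n = Set.univ → halfSum G ≤ n

theorem two_mem_reach {G : Type*} [AddCommGroup G] {A : Set G} {a b : G} (ha : a ∈ A) (hb : b ∈ A) {x y : ℤ} {n : ℕ}
    (h : x.natAbs + y.natAbs ≤ n) : x • a + y • b ∈ reach A n :=
  reach_mono h (add_mem_reach (zsmul_mem_reach ha x) (zsmul_mem_reach hb y))

theorem three_mem_reach {G : Type*} [AddCommGroup G] {A : Set G} {a b c : G} (ha : a ∈ A) (hb : b ∈ A) (hc : c ∈ A) {x y z : ℤ} {n : ℕ}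
    (h : z.natAbs + x.natAbs + y.natAbs ≤ n) : z • c + x • a + y • b ∈ reach A n :=
  reach_mono h (add_mem_reach (add_mem_reach (zsmul_mem_reach hc z) (zsmul_mem_reach ha x))
    (zsmul_mem_reach hb y))

namespace Extremal

variable {G : Type*} [AddCommGroup G] [Finite G] {A : Set G}

/-- The source of all contradictions: combined with `halfSum_add_le`, it forbids covering the kernel
in fewer steps than its share of `halfSum G`. -/
theorem halfSum_le {Q : Type*} [AddCommGroup Q] [Finite Q] (hA : Extremal A)
    (φ : G →+ Q) (hφ : Function.Surjective φ) {n : ℕ} (hn : ∀ x, φ x = 0 → x ∈ reach A n) :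
    halfSum G ≤ n + halfSum Q :=
  hA.le _ (reach_eq_univ_of_ker φ hn (reach_halfSum (closure_image_eq_top hA.closure_eq φ hφ)))

theorem image {Q : Type*} [AddCommGroup Q] [Finite Q] (hA : Extremal A)
    (φ : G →+ Q) (hφ : Function.Surjective φ) {n : ℕ} (hn : ∀ x, φ x = 0 → x ∈ reach A n)
    (hQ : n + halfSum Q ≤ halfSum G) : Extremal (φ '' A) where
  closure_eq := closure_image_eq_top hA.closure_eq φ hφ
  zero_mem := ⟨0, hA.zero_mem, map_zero φ⟩
  neg_mem := by
    rintro _ ⟨x, hx, rfl⟩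
    exact ⟨-x, hA.neg_mem x hx, map_neg φ x⟩
  le := by
    intro k hk
    have := hA.le _ (reach_eq_univ_of_ker φ hn hk)
    omega

/-- The multiples of `a` in an extremal set containing `a` are only `0`, `a` and `-a`. -/
theorem eq_of_mem_zmultiples (hA : Extremal A) {a c : G} (ha : a ∈ A) (hc : c ∈ A)
    (h : c ∈ AddSubgroup.zmultiples a) : c = 0 ∨ c = a ∨ c = -a := by
  obtain ⟨k, hk, hkd⟩ := exists_zsmul_eq_natAbs_le h
  rcases Nat.lt_or_ge k.natAbs 2 with hk2 | hk2
  · have : k = 0 ∨ k = 1 ∨ k = -1 := by omega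
    rcases this with rfl | rfl | rfl <;> simp [hk]
  · exfalso
    have hφ := QuotientAddGroup.mk'_surjective (AddSubgroup.zmultiples a)
    have hker := mk_zmultiples_eq_zero_iff a
    have h1 := halfSum_add_le _ hφ hker
    have h2 := hA.halfSum_le _ hφ (n := addOrderOf a / 2 - 1) fun x hx => by
      obtain ⟨m, rfl, hm⟩ := exists_zsmul_eq_natAbs_le ((hker x).1 hx)
      have hplus : m • a = 1 • c + (m - k) • a := by rw [hk]; module
      have hminus : m • a = (-1 : ℤ) • c + (m + k) • a := by rw [hk]; module
      -- Only `|m| = ⌊ord a / 2⌋` needs shortening: one summand `±c` replaces `|k| ≥ 2` summands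
      -- `±a`.
      by_cases hm' : m.natAbs ≤ addOrderOf a / 2 - 1
      · exact zsmul_mem_reach_of_le ha hm'
      · rcases (by omega : (1 + (m - k).natAbs ≤ addOrderOf a / 2 - 1) ∨
          (1 + (m + k).natAbs ≤ addOrderOf a / 2 - 1)) with h | h
        · rw [hplus]
          exact reach_mono h (add_mem_reach (nsmul_mem_reach hc 1) (zsmul_mem_reach ha _))
        · rw [hminus]
          exact reach_mono h (add_mem_reach (neg_one_zsmul c ▸ neg_mem_reach (mem_reach_of_mem hc)) (zsmul_mem_reach ha _))
    omega

end Extremal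

/-! ### Factoring out two elements -/

section TwoStep

variable {G : Type*} [AddCommGroup G]

/-- The quotient of `G` by `⟨a⟩` and then by the image of `b`. -/
abbrev Quot₂ (a b : G) : Type _ :=
  (G ⧸ AddSubgroup.zmultiples a) ⧸
    AddSubgroup.zmultiples (QuotientAddGroup.mk' (AddSubgroup.zmultiples a) b)

/-- The projection of `G` to `Quot₂ a b`. -/
def proj₂ (a b : G) : G →+ Quot₂ a b :=
  (QuotientAddGroup.mk' (AddSubgroup.zmultiples
    (QuotientAddGroup.mk' (AddSubgroup.zmultiples a) b))).comp
      (QuotientAddGroup.mk' (AddSubgroup.zmultiples a))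

theorem proj₂_surjective (a b : G) : Function.Surjective (proj₂ a b) :=
  (QuotientAddGroup.mk'_surjective _).comp (QuotientAddGroup.mk'_surjective _)

theorem proj₂_eq_zero_iff (a b x : G) : proj₂ a b x = 0 ↔ ∃ m n : ℤ, x = m • a + n • b := by
  rw [proj₂, AddMonoidHom.comp_apply, mk_zmultiples_eq_zero_iff]
  constructor
  · rintro ⟨n, hn⟩
    have h : QuotientAddGroup.mk' (AddSubgroup.zmultiples a) (x - n • b) = 0 := by
      simp only at hn
      rw [map_sub, map_zsmul, hn, sub_self]
    obtain ⟨m, hm⟩ := (mk_zmultiples_eq_zero_iff a _).1 h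
    simp only at hm
    exact ⟨m, n, by rw [hm]; abel⟩
  · rintro ⟨m, n, rfl⟩
    refine ⟨n, ?_⟩
    have h : QuotientAddGroup.mk' (AddSubgroup.zmultiples a) a = 0 :=
      (mk_zmultiples_eq_zero_iff a a).2 (AddSubgroup.mem_zmultiples a)
    simp only
    rw [map_add, map_zsmul, map_zsmul, h, smul_zero, zero_add]

/-- The order of `b` modulo `⟨a⟩`. -/
noncomputable def relOrder (a b : G) : ℕ :=
  addOrderOf (QuotientAddGroup.mk' (AddSubgroup.zmultiples a) b)

theorem relOrder_zsmul_mem (a b : G) {n : ℤ} :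
    n • b ∈ AddSubgroup.zmultiples a ↔ (relOrder a b : ℤ) ∣ n := by
  rw [relOrder, addOrderOf_dvd_iff_zsmul_eq_zero, ← map_zsmul, mk_zmultiples_eq_zero_iff]

theorem relOrder_eq_addOrderOf {a b : G}
    (h : ∀ x, x ∈ AddSubgroup.zmultiples a → x ∈ AddSubgroup.zmultiples b → x = 0) :
    relOrder a b = addOrderOf b := by
  refine Nat.dvd_antisymm ?_ ?_
  · rw [← Int.natCast_dvd_natCast, ← relOrder_zsmul_mem, natCast_zsmul, addOrderOf_nsmul_eq_zero]
    exact zero_mem _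
  · rw [← Int.natCast_dvd_natCast, addOrderOf_dvd_iff_zsmul_eq_zero]
    exact h _ ((relOrder_zsmul_mem a b).2 dvd_rfl) ⟨_, rfl⟩

variable [Finite G]

theorem exists_proj₂_rep {a b x : G} (hx : proj₂ a b x = 0) :
    ∃ m n : ℤ, x = m • a + n • b ∧ m.natAbs ≤ addOrderOf a / 2 ∧ n.natAbs ≤ relOrder a b / 2 := by
  rw [proj₂, AddMonoidHom.comp_apply, mk_zmultiples_eq_zero_iff] at hx
  obtain ⟨n, hn, hn'⟩ := exists_zsmul_eq_natAbs_le hx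
  have h : QuotientAddGroup.mk' (AddSubgroup.zmultiples a) (x - n • b) = 0 := by
    rw [map_sub, map_zsmul, hn, sub_self]
  obtain ⟨m, hm, hm'⟩ := exists_zsmul_eq_natAbs_le ((mk_zmultiples_eq_zero_iff a _).1 h)
  exact ⟨m, n, by rw [← hm]; abel, hm', hn'⟩

theorem halfSum_add_two_le (a b : G) :
    addOrderOf a / 2 + relOrder a b / 2 + halfSum (Quot₂ a b) ≤ halfSum G := by
  have h1 := halfSum_add_le _ (QuotientAddGroup.mk'_surjective _) (mk_zmultiples_eq_zero_iff a)
  have h2 := halfSum_add_le _ (QuotientAddGroup.mk'_surjective _) (mk_zmultiples_eq_zero_iff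
    (QuotientAddGroup.mk' (AddSubgroup.zmultiples a) b))
  exact (by rw [add_assoc]; exact Nat.add_le_add_left h2 _ : _ ≤ _).trans h1

end TwoStep

/-! ### Pairs of elements of an extremal set. -/

namespace Extremal

variable {G : Type*} [AddCommGroup G] [Finite G] {A : Set G}

theorem two_step (hA : Extremal A) (a b : G) {n : ℕ}
    (h : ∀ x y : ℤ, x.natAbs ≤ addOrderOf a / 2 → y.natAbs ≤ relOrder a b / 2 →
      x • a + y • b ∈ reach A n) : addOrderOf a / 2 + relOrder a b / 2 ≤ n := by
  have h1 := halfSum_add_two_le a b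
  have h2 := hA.halfSum_le _ (proj₂_surjective a b) (n := n) fun x hx => by
    obtain ⟨p, q, rfl, hp, hq⟩ := exists_proj₂_rep hx
    exact h p q hp hq
  omega

/-- Otherwise there is a relation `d₂ b = c a` with `c ≠ 0` and `|c| ≤ d₁ / 2`, and it shortens
every longest combination of `a` and `b`, contradicting `two_step`. -/
theorem disjoint_zmultiples (hA : Extremal A) {a b : G} (ha : a ∈ A) (hb : b ∈ A)
    (hba : b ∉ AddSubgroup.zmultiples a) (hab : a ∉ AddSubgroup.zmultiples b) :
    ∀ x, x ∈ AddSubgroup.zmultiples a → x ∈ AddSubgroup.zmultiples b → x = 0 := by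
  obtain ⟨c, hc, hcd⟩ := exists_zsmul_eq_natAbs_le
    ((relOrder_zsmul_mem a b).2 (dvd_refl (relOrder a b : ℤ)))
  set d₁ := addOrderOf a with hd₁
  set d₂ := relOrder a b with hd₂
  by_cases hc0 : c = 0
  · rintro x hxa ⟨y, rfl⟩
    obtain ⟨w, rfl⟩ := (relOrder_zsmul_mem a b).1 hxa
    simp only
    rw [mul_comm, mul_smul, ← hd₂, hc, hc0, zero_smul, smul_zero]
  exfalso
  have hd₂2 : 2 ≤ d₂ := by
    by_contra hlt
    have : (d₂ : ℤ) ∣ 1 := by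
      have h0 : d₂ ≠ 0 := (addOrderOf_pos _).ne'
      have : d₂ = 1 := by omega
      simp [this]
    rw [hd₂, ← relOrder_zsmul_mem, one_smul] at this
    exact hba this
  have hmem : c • a ∈ AddSubgroup.zmultiples b := ⟨d₂, hc⟩
  have hd₁a : (d₁ : ℤ) • a = 0 := by rw [natCast_zsmul]; exact addOrderOf_nsmul_eq_zero a
  have hc1 : c.natAbs ≠ 1 := by
    intro h
    rcases (by omega : c = 1 ∨ c = -1) with rfl | rfl
    · exact hab (by simpa using hmem)
    · exact hab (by simpa using hmem)
  -- For odd `d₁` the element `2 a` generates `⟨a⟩`, so that `a` would be a multiple of `b`.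
  have hc2 : ¬ (c.natAbs = 2 ∧ d₁ % 2 = 1) := by
    rintro ⟨h, hodd⟩
    have key : ((d₁ + 1) / 2 : ℤ) • (2 : ℤ) • a = a := by
      rw [smul_smul]
      have : ((d₁ + 1) / 2 : ℤ) * 2 = d₁ + 1 := by omega
      rw [this, add_smul, hd₁a, zero_add, one_smul]
    apply hab
    rw [← key]
    refine AddSubgroup.zsmul_mem _ ?_ _
    rcases (by omega : c = 2 ∨ c = -2) with rfl | rfl
    · exact hmem
    · simpa using hmem
  have := hA.two_step a b (n := d₁ / 2 + d₂ / 2 - 1) fun x y hx hy => by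
    rw [← hd₁] at hx
    rw [← hd₂] at hy
    by_cases h : x.natAbs + y.natAbs ≤ d₁ / 2 + d₂ / 2 - 1
    · exact two_mem_reach ha hb h
    -- Only the corners `|x| = ⌊d₁ / 2⌋`, `|y| = ⌊d₂ / 2⌋` remain. Moving `y` by `d₂` towards the
    -- other sign costs at most one step, and by the excluded values of `c` the shift of `x` by
    -- `±c`, reduced modulo `d₁`, saves at least two.
    have step : ∀ s t : ℤ, (x + t * c + s * d₁).natAbs + (y - t * d₂).natAbs ≤
        d₁ / 2 + d₂ / 2 - 1 → x • a + y • b ∈ reach A (d₁ / 2 + d₂ / 2 - 1) := by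
      intro s t hst
      have e : x • a + y • b = (x + t * c + s * d₁) • a + (y - t * d₂) • b := by
        rw [add_smul, add_smul, sub_smul, mul_smul, mul_smul, mul_smul, hd₁a, hc]
        module
      rw [e]
      exact two_mem_reach ha hb hst
    rcases le_or_gt 0 y with hy0 | hy0
    · rcases le_or_gt 0 (x + c) with hxc | hxc
      · rcases le_or_gt (x + c) (d₁ / 2 : ℕ) with hxc' | hxc'
        · exact step 0 1 (by omega)
        · exact step (-1) 1 (by omega)
      · rcases le_or_gt (-(x + c)) (d₁ / 2 : ℕ) with hxc' | hxc'
        · exact step 0 1 (by omega)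
        · exact step 1 1 (by omega)
    · rcases le_or_gt 0 (x - c) with hxc | hxc
      · rcases le_or_gt (x - c) (d₁ / 2 : ℕ) with hxc' | hxc'
        · exact step 0 (-1) (by omega)
        · exact step (-1) (-1) (by omega)
      · rcases le_or_gt (-(x - c)) (d₁ / 2 : ℕ) with hxc' | hxc'
        · exact step 0 (-1) (by omega)
        · exact step 1 (-1) (by omega)
  omega

/-- Let `c` have coordinates `(x₀, y₀)`. At corners whose signs agree, one copy of `±c` replaces at
least two steps. At mixed corners one coordinate is also wrapped around modulo its order, which is
free for even order and costs one step for odd order. If both orders are odd and `x₀ = y₀ = 1`, two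
copies of `±c` are needed, and these gain enough unless both orders are `3`. -/
theorem exists_shorter {d₁ d₂ x₀ y₀ x y : ℤ} (h₁ : 2 ≤ d₁) (h₂ : 2 ≤ d₂)
    (h3 : ¬ (d₁ = 3 ∧ d₂ = 3)) (hx₀ : 0 < x₀) (hx₀' : x₀ ≤ d₁ / 2) (hy₀ : 0 < y₀)
    (hy₀' : y₀ ≤ d₂ / 2) (hx : x = d₁ / 2 ∨ x = -(d₁ / 2)) (hy : y = d₂ / 2 ∨ y = -(d₂ / 2)) :
    ∃ k s t : ℤ, |k| + |x - k * x₀ + s * d₁| + |y - k * y₀ + t * d₂| + 1 ≤ d₁ / 2 + d₂ / 2 := by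
  simp only [abs_eq_max_neg]
  rcases hx with hx | hx <;> rcases hy with hy | hy
  · exact ⟨1, 0, 0, by omega⟩
  · by_cases e2 : d₂ % 2 = 0
    · exact ⟨1, 0, 1, by omega⟩
    by_cases e1 : d₁ % 2 = 0
    · exact ⟨-1, -1, 0, by omega⟩
    by_cases h : x₀ + y₀ = 2
    · by_cases hf : 4 ≤ d₁
      · exact ⟨2, 0, 1, by omega⟩
      · exact ⟨-2, -1, 0, by omega⟩
    · exact ⟨1, 0, 1, by omega⟩
  · by_cases e2 : d₂ % 2 = 0
    · exact ⟨-1, 0, -1, by omega⟩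
    by_cases e1 : d₁ % 2 = 0
    · exact ⟨1, 1, 0, by omega⟩
    by_cases h : x₀ + y₀ = 2
    · by_cases hf : 4 ≤ d₁
      · exact ⟨-2, 0, -1, by omega⟩
      · exact ⟨2, 1, 0, by omega⟩
    · exact ⟨-1, 0, -1, by omega⟩
  · exact ⟨-1, 0, 0, by omega⟩

theorem two_le_addOrderOf {a : G} (ha : a ≠ 0) : 2 ≤ addOrderOf a := by
  have h1 : addOrderOf a ≠ 1 := fun h => ha (AddMonoid.addOrderOf_eq_one_iff.1 h)
  have h2 := addOrderOf_pos a
  omega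

/-- A third element in the subgroup generated by two independent elements of an extremal set
exists only if these have order `3`. -/
theorem addOrderOf_eq_three_of_pos (hA : Extremal A) {a b : G} (ha : a ∈ A) (hb : b ∈ A)
    (hba : b ∉ AddSubgroup.zmultiples a) (hab : a ∉ AddSubgroup.zmultiples b) {x₀ y₀ : ℤ}
    (hx₀ : 0 < x₀) (hx₀' : x₀ ≤ addOrderOf a / 2) (hy₀ : 0 < y₀) (hy₀' : y₀ ≤ addOrderOf b / 2)
    (hc : x₀ • a + y₀ • b ∈ A) : addOrderOf a = 3 ∧ addOrderOf b = 3 := by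
  by_contra h3
  have hrel := relOrder_eq_addOrderOf (hA.disjoint_zmultiples ha hb hba hab)
  set d₁ := addOrderOf a with hd₁
  set d₂ := addOrderOf b with hd₂
  have h1 : 2 ≤ d₁ := two_le_addOrderOf fun h => hab (by rw [h]; exact AddSubgroup.zero_mem _)
  have h2 : 2 ≤ d₂ := two_le_addOrderOf fun h => hba (by rw [h]; exact AddSubgroup.zero_mem _)
  have hd₁a : (d₁ : ℤ) • a = 0 := by rw [natCast_zsmul]; exact addOrderOf_nsmul_eq_zero a
  have hd₂b : (d₂ : ℤ) • b = 0 := by rw [natCast_zsmul]; exact addOrderOf_nsmul_eq_zero b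
  have := hA.two_step a b (n := d₁ / 2 + d₂ / 2 - 1) fun x y hx hy => by
    rw [← hd₁] at hx
    rw [hrel] at hy
    by_cases h : x.natAbs + y.natAbs ≤ d₁ / 2 + d₂ / 2 - 1
    · exact two_mem_reach ha hb h
    obtain ⟨k, s, t, hkst⟩ := exists_shorter (d₁ := d₁) (d₂ := d₂) (x := x) (y := y)
      (by omega) (by omega) (by omega) hx₀ hx₀' hy₀ hy₀' (by omega) (by omega)
    have e : x • a + y • b =
        k • (x₀ • a + y₀ • b) + (x - k * x₀ + s * d₁) • a + (y - k * y₀ + t * d₂) • b := by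
      rw [add_smul, add_smul, sub_smul, sub_smul, mul_smul s, mul_smul t, hd₁a, hd₂b]
      module
    rw [e]
    refine three_mem_reach ha hb hc ?_
    simp only [Int.abs_eq_natAbs] at hkst
    omega
  rw [hrel] at this
  omega

theorem mem_span_pair (hA : Extremal A) {a b c : G} (ha : a ∈ A) (hb : b ∈ A) (hcA : c ∈ A)
    (hba : b ∉ AddSubgroup.zmultiples a) (hab : a ∉ AddSubgroup.zmultiples b)
    (hc : proj₂ a b c = 0) :
    c = 0 ∨ c = a ∨ c = -a ∨ c = b ∨ c = -b ∨ (addOrderOf a = 3 ∧ addOrderOf b = 3 ∧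
      (c = a + b ∨ c = a - b ∨ c = -a + b ∨ c = -a - b)) := by
  have hrel := relOrder_eq_addOrderOf (hA.disjoint_zmultiples ha hb hba hab)
  obtain ⟨x, y, rfl, hx, hy⟩ := exists_proj₂_rep hc
  rw [hrel] at hy
  by_cases hx0 : x = 0
  · subst hx0
    rw [zero_smul, zero_add] at hcA ⊢
    rcases hA.eq_of_mem_zmultiples hb hcA ⟨y, rfl⟩ with h | h | h <;> simp [h]
  by_cases hy0 : y = 0
  · subst hy0
    rw [zero_smul, add_zero] at hcA ⊢
    rcases hA.eq_of_mem_zmultiples ha hcA ⟨x, rfl⟩ with h | h | h <;> simp [h]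
  have h3 : addOrderOf a = 3 ∧ addOrderOf b = 3 := by
    -- Replacing `a` or `b` by its negative makes both coefficients positive.
    rcases lt_or_gt_of_ne hx0 with hxs | hxs <;> rcases lt_or_gt_of_ne hy0 with hys | hys
    · have := hA.addOrderOf_eq_three_of_pos (a := -a) (b := -b) (x₀ := -x) (y₀ := -y)
        (hA.neg_mem a ha) (hA.neg_mem b hb) (by simpa using hba) (by simpa using hab)
        (by omega) (by rw [addOrderOf_neg]; omega) (by omega) (by rw [addOrderOf_neg]; omega)
        (by simpa using hcA)
      simpa using this
    · have := hA.addOrderOf_eq_three_of_pos (a := -a) (b := b) (x₀ := -x) (y₀ := y)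
        (hA.neg_mem a ha) hb (by simpa using hba) (by simpa using hab)
        (by omega) (by rw [addOrderOf_neg]; omega) (by omega) (by omega) (by simpa using hcA)
      simpa using this
    · have := hA.addOrderOf_eq_three_of_pos (a := a) (b := -b) (x₀ := x) (y₀ := -y)
        ha (hA.neg_mem b hb) (by simpa using hba) (by simpa using hab)
        (by omega) (by omega) (by omega) (by rw [addOrderOf_neg]; omega) (by simpa using hcA)
      simpa using this
    · exact hA.addOrderOf_eq_three_of_pos ha hb hba hab hxs (by omega) hys (by omega) hcA
  rw [h3.1] at hx
  rw [h3.2] at hy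
  obtain rfl | rfl : x = 1 ∨ x = -1 := by omega
  all_goals
    obtain rfl | rfl : y = 1 ∨ y = -1 := by omega
    all_goals simp [h3, sub_eq_add_neg]

/-- Write `d₁ = u g`, `d₂ = v g` with coprime `u, v ≥ 2`. Then `u v ≥ u + v + 1`; for `g = 1` the
rounding is harmless since `u` and `v` are not both even. -/
theorem half_lt_lcm_half {d₁ d₂ : ℕ} (h₁ : 0 < d₁) (h₂ : 0 < d₂) (h : ¬ d₁ ∣ d₂) (h' : ¬ d₂ ∣ d₁) :
    d₁ / 2 + d₂ / 2 < Nat.lcm d₁ d₂ / 2 := by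
  obtain ⟨g, u, v, hg, hcop, rfl, rfl⟩ := Nat.exists_coprime' (Nat.gcd_pos_of_pos_left d₂ h₁)
  rw [Nat.lcm_mul_right, hcop.lcm_eq_mul]
  have hu : 2 ≤ u := by
    by_contra hlt
    have : u ≠ 0 := by rintro rfl; simp at h₁
    have : u = 1 := by omega
    subst this
    exact h ⟨v, by ring⟩
  have hv : 2 ≤ v := by
    by_contra hlt
    have : v ≠ 0 := by rintro rfl; simp at h₂
    have : v = 1 := by omega
    subst this
    exact h' ⟨u, by ring⟩
  have hodd : ¬ (2 ∣ u ∧ 2 ∣ v) := fun ⟨h1, h2⟩ => Nat.not_coprime_of_dvd_of_dvd one_lt_two h1 h2 hcop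
  have huv : u + v + 1 ≤ u * v := by
    have : u ≠ v := by
      rintro rfl
      rw [Nat.coprime_self] at hcop
      omega
    rcases Nat.lt_or_ge u v with hlt | hge
    · nlinarith
    · nlinarith [show v + 1 ≤ u by omega]
  have hm : (u + v + 1) * g ≤ u * v * g := Nat.mul_le_mul_right _ huv
  rcases Nat.lt_or_ge g 2 with hg2 | hg2
  · have : g = 1 := by omega
    subst this
    omega
  · have e : (u + v + 1) * g = u * g + v * g + g := by ring
    omega

/-- Otherwise `⟨a, b⟩` contains an element `c` whose order is the least common multiple, and writing
the multiples of `c` in terms of `a` and `b` covers `⟨c⟩` too fast. -/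
theorem addOrderOf_dvd_or_dvd (hA : Extremal A) {a b : G} (ha : a ∈ A) (hb : b ∈ A) :
    addOrderOf a ∣ addOrderOf b ∨ addOrderOf b ∣ addOrderOf a := by
  by_contra! h
  have hlt := half_lt_lcm_half (addOrderOf_pos a) (addOrderOf_pos b) h.1 h.2
  obtain ⟨c, hc, hord⟩ := (AddCommute.all a b).exists_addOrderOf_eq_lcm
  have h1 := halfSum_add_le _ (QuotientAddGroup.mk'_surjective _) (mk_zmultiples_eq_zero_iff c)
  have h2 := hA.halfSum_le _ (QuotientAddGroup.mk'_surjective (AddSubgroup.zmultiples c))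
    (n := addOrderOf a / 2 + addOrderOf b / 2) fun x hx => by
      rw [mk_zmultiples_eq_zero_iff] at hx
      have hle : AddSubgroup.zmultiples c ≤ AddSubgroup.closure {a, b} :=
        AddSubgroup.zmultiples_le_of_mem
          (AddSubgroup.le_closure_toAddSubmonoid _ hc)
      obtain ⟨m, n, rfl⟩ := AddSubgroup.mem_closure_pair.1 (hle hx)
      exact add_mem_reach (zmultiples_subset_reach ha ⟨m, rfl⟩)
        (zmultiples_subset_reach hb ⟨n, rfl⟩)
  rw [hord] at h1
  omega

/-- An element of `A` of maximal order has order divisible by all orders in `A`; since `A`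
generates, this order annihilates `G`. -/
theorem exists_addOrderOf_eq_invSeq (hA : Extremal A) : ∃ a ∈ A, addOrderOf a = invSeq G 0 := by
  obtain ⟨a, ha, hmax⟩ := A.toFinite.exists_maximalFor addOrderOf A ⟨0, hA.zero_mem⟩
  have hdvd : ∀ b ∈ A, addOrderOf b ∣ addOrderOf a := by
    intro b hb
    rcases hA.addOrderOf_dvd_or_dvd ha hb with h | h
    · have h1 := Nat.le_of_dvd (addOrderOf_pos b) h
      have h2 := hmax hb h1
      rw [le_antisymm h1 h2]
    · exact h
  refine ⟨a, ha, Nat.dvd_antisymm ?_ ?_⟩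
  · exact addOrderOf_dvd_iff_nsmul_eq_zero.2 (invSeq_zero_nsmul a)
  -- For `i = 0` the criterion says that `k G` is trivial.
  · rw [← smulGen_iff]
    refine ⟨fun t => t.elim0, fun x => ⟨fun t => t.elim0, ?_⟩⟩
    have h : AddSubgroup.closure A ≤ (nsmulAddMonoidHom (α := G) (addOrderOf a)).ker := by
      rw [AddSubgroup.closure_le]
      intro b hb
      exact addOrderOf_dvd_iff_nsmul_eq_zero.1 (hdvd b hb)
    rw [hA.closure_eq] at h
    simpa using h (AddSubgroup.mem_top x)

end Extremal

end Extremal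

/-! ### The upper bound for the cardinality. -/

section Counting

/-- The number of elements of `{b, -b}` for `b` of order `m`, except that there are none for
`m = 1`. -/
def weight (m : ℕ) : ℕ := if m = 1 then 0 else if m = 2 then 1 else 2

variable (G : Type*) [AddCommGroup G] [Finite G]

/-- The sum of the weights of the invariant factors. -/
noncomputable def weightSum : ℕ := ∑ i ∈ Finset.range (rk G), weight (invSeq G i)

/-- The number of invariant factors equal to `3`. -/
noncomputable def threes : ℕ := ∑ i ∈ Finset.range (rk G), if invSeq G i = 3 then 1 else 0

/-- The largest cardinality of an extremal set. -/
noncomputable def cardBound : ℕ := 1 + weightSum G + 2 * (threes G / 2)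

variable {G}

theorem sum_range_rk_eq {f : ℕ → ℕ} (hf : f 1 = 0) {R : ℕ} (hR : rk G ≤ R) :
    ∑ i ∈ Finset.range (rk G), f (invSeq G i) = ∑ i ∈ Finset.range R, f (invSeq G i) := by
  rw [← Finset.sum_range_add_sum_Ico _ hR, Finset.sum_eq_zero (s := Finset.Ico _ _), add_zero]
  intro i hi
  rw [invSeq_eq_one G (Finset.mem_Ico.1 hi).1, hf]

theorem sum_range_rk_of_shift {Q : Type*} [AddCommGroup Q] [Finite Q] {f : ℕ → ℕ} (hf : f 1 = 0)
    (h : ∀ i, invSeq Q i = invSeq G (i + 1)) :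
    ∑ i ∈ Finset.range (rk G), f (invSeq G i) =
      f (invSeq G 0) + ∑ i ∈ Finset.range (rk Q), f (invSeq Q i) := by
  rw [sum_range_rk_eq hf (R := max (rk G) (rk Q) + 1) (by omega),
    sum_range_rk_eq hf (G := Q) (R := max (rk G) (rk Q)) (by omega), Finset.sum_range_succ', add_comm]
  simp only [h]

theorem weightSum_of_shift {Q : Type*} [AddCommGroup Q] [Finite Q]
    (h : ∀ i, invSeq Q i = invSeq G (i + 1)) :
    weightSum G = weight (invSeq G 0) + weightSum Q :=
  sum_range_rk_of_shift (f := weight) rfl h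

theorem threes_of_shift {Q : Type*} [AddCommGroup Q] [Finite Q]
    (h : ∀ i, invSeq Q i = invSeq G (i + 1)) :
    threes G = (if invSeq G 0 = 3 then 1 else 0) + threes Q :=
  sum_range_rk_of_shift (f := fun m => if m = 3 then 1 else 0) rfl h

/-- If a homomorphism is injective on the part of `A` outside its kernel, then `|A|` is controlled
by the part of `A` in the kernel and by the image of `A`. -/
theorem ncard_add_one_le {G Q : Type*} [AddCommGroup G] [Finite G] [AddCommGroup Q] [Finite Q]
    {A K : Set G} (π : G →+ Q)
    (h0 : (0 : G) ∈ A) (hK : ∀ x ∈ A, π x = 0 → x ∈ K)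
    (hinj : ∀ b ∈ A, ∀ c ∈ A, π b ≠ 0 → π b = π c → b = c) :
    A.ncard + 1 ≤ K.ncard + (π '' A).ncard := by
  set B := {x ∈ A | π x ≠ 0} with hB
  have h1 : A ⊆ K ∪ B := by
    intro x hx
    by_cases h : π x = 0
    · exact Or.inl (hK x hx h)
    · exact Or.inr ⟨hx, h⟩
  have h2 : A.ncard ≤ K.ncard + B.ncard :=
    (Set.ncard_le_ncard h1 (Set.toFinite _)).trans (Set.ncard_union_le _ _)
  have h3 : (π '' B).ncard = B.ncard := by
    refine Set.InjOn.ncard_image ?_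
    rintro x ⟨hx, hx0⟩ y ⟨hy, -⟩ hxy
    exact hinj x hx y hy hx0 hxy
  have h4 : insert 0 (π '' B) ⊆ π '' A := by
    rw [Set.insert_subset_iff]
    exact ⟨⟨0, h0, map_zero π⟩, Set.image_mono fun x hx => hx.1⟩
  have h5 : (0 : Q) ∉ π '' B := by
    rintro ⟨x, ⟨-, hx⟩, hx0⟩
    exact hx hx0
  have h6 := Set.ncard_le_ncard h4 (Set.toFinite _)
  rw [Set.ncard_insert_of_notMem h5 (Set.toFinite _), h3] at h6
  omega

theorem addOrderOf_eq_three_iff {G : Type*} [AddCommGroup G] {a : G} (ha : a ≠ 0) :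
    addOrderOf a = 3 ↔ (3 : ℤ) • a = 0 := by
  constructor
  · intro h
    have h' := addOrderOf_nsmul_eq_zero a
    rw [h] at h'
    exact_mod_cast h'
  · intro h
    have : Fact (Nat.Prime 3) := ⟨Nat.prime_three⟩
    refine addOrderOf_eq_prime ?_ ha
    exact_mod_cast h

theorem eq_of_natAbs_le_half_three {x : ℤ} (h : x.natAbs ≤ 3 / 2) : x = 0 ∨ x = 1 ∨ x = -1 := by
  omega

theorem zmultiples_of_three {G : Type*} [AddCommGroup G] [Finite G] {a x : G}
    (ha : addOrderOf a = 3) (hx : x ∈ AddSubgroup.zmultiples a) : x = 0 ∨ x = a ∨ x = -a := by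
  obtain ⟨k, rfl, hk⟩ := exists_zsmul_eq_natAbs_le hx
  rw [ha] at hk
  rcases eq_of_natAbs_le_half_three hk with rfl | rfl | rfl <;> simp

theorem add_mem_reach_two {G : Type*} [AddCommGroup G] {A : Set G} {x y z : G} (hx : x ∈ A) (hy : y ∈ A) (h : z = x + y) :
    z ∈ reach A 2 := h ▸ add_mem_reach (mem_reach_of_mem hx) (mem_reach_of_mem hy)

namespace Extremal

variable {A : Set G}

/-- Three independent elements of order `3` need at least three steps to cover their span. -/
theorem three_step (hA : Extremal A) {a b c : G} (ha : addOrderOf a = 3) (hb : relOrder a b = 3)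
    (hc : addOrderOf c = 3) (hcab : proj₂ a b c ≠ 0)
    (h : ∀ x y z : ℤ, (x = 0 ∨ x = 1 ∨ x = -1) → (y = 0 ∨ y = 1 ∨ y = -1) → (z = 0 ∨ z = 1) →
      x • a + y • b + z • c ∈ reach A 2) : False := by
  have h1 := halfSum_add_two_le a b
  have hord : addOrderOf (proj₂ a b c) = 3 := by
    rw [addOrderOf_eq_three_iff hcab, ← map_zsmul,
      (addOrderOf_eq_three_iff (fun h => hcab (by rw [h, map_zero]))).1 hc, map_zero]
  have h2 := halfSum_add_le _ (QuotientAddGroup.mk'_surjective _)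
    (mk_zmultiples_eq_zero_iff (proj₂ a b c))
  have h' : ∀ x y z : ℤ, (x = 0 ∨ x = 1 ∨ x = -1) → (y = 0 ∨ y = 1 ∨ y = -1) →
      (z = 0 ∨ z = 1 ∨ z = -1) → x • a + y • b + z • c ∈ reach A 2 := by
    intro x y z hx hy hz
    rcases hz with hz | hz | hz
    · exact h x y z hx hy (Or.inl hz)
    · exact h x y z hx hy (Or.inr hz)
    · have := neg_mem_reach (h (-x) (-y) (-z) (by omega) (by omega) (by omega))
      have e : x • a + y • b + z • c = -(-x • a + -y • b + -z • c) := by module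
      rw [e]; exact this
  have h3 := hA.halfSum_le (Q := Quot₂ a b ⧸ AddSubgroup.zmultiples (proj₂ a b c))
    ((QuotientAddGroup.mk' (AddSubgroup.zmultiples (proj₂ a b c))).comp (proj₂ a b))
    ((QuotientAddGroup.mk'_surjective _).comp (proj₂_surjective a b)) (n := 2) fun x hx => by
    rw [AddMonoidHom.comp_apply, mk_zmultiples_eq_zero_iff] at hx
    obtain ⟨z, hz, hz'⟩ := exists_zsmul_eq_natAbs_le hx
    have hx' : proj₂ a b (x - z • c) = 0 := by rw [map_sub, map_zsmul, hz, sub_self]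
    obtain ⟨p, q, hpq, hp, hq⟩ := exists_proj₂_rep hx'
    rw [sub_eq_iff_eq_add] at hpq
    rw [hpq]
    rw [ha] at hp; rw [hb] at hq; rw [hord] at hz'
    exact h' p q z (eq_of_natAbs_le_half_three hp) (eq_of_natAbs_le_half_three hq)
      (eq_of_natAbs_le_half_three hz')
  rw [ha, hb] at h1
  rw [hord] at h2
  omega

/-- Two disjoint pairs with the same difference. -/
theorem not_two_triples (hA : Extremal A) {a b c : G} (ha : a ∈ A) (hb : b ∈ A) (hc : c ∈ A)
    (hab : a + b ∈ A) (hac : c + a ∈ A) (ha3 : addOrderOf a = 3) (hb3 : relOrder a b = 3)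
    (hc3 : addOrderOf c = 3) (hcab : proj₂ a b c ≠ 0) : False := by
  have h3 : (3 : ℤ) • a = 0 :=
    (addOrderOf_eq_three_iff (fun h => by rw [h, addOrderOf_zero] at ha3; omega)).1 ha3
  have h0 := hA.zero_mem
  have hn := hA.neg_mem
  refine hA.three_step ha3 hb3 hc3 hcab ?_
  rintro x y z hx hy (rfl | rfl)
  · rw [zero_smul, add_zero]
    exact two_mem_reach ha hb (by omega)
  · rcases hy with rfl | rfl | rfl
    · rw [zero_smul, add_zero]
      exact two_mem_reach ha hc (by omega)
    · rcases hx with rfl | rfl | rfl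
      · exact add_mem_reach_two hb hc (by module)
      · exact add_mem_reach_two hab hc (by module)
      -- `-a = 2 a`, so the target is `(a + b) + (c + a)`.
      · refine add_mem_reach_two hab hac ?_
        rw [← sub_eq_zero, ← neg_eq_zero, ← h3]; module
    · rcases hx with rfl | rfl | rfl
      · exact add_mem_reach_two (hn _ hb) hc (by module)
      · exact add_mem_reach_two (hn _ hb) hac (by module)
      · exact add_mem_reach_two (hn _ hab) hc (by module)

/-- A triple and a pair differing by the missing difference. -/
theorem not_triple_of_sub (hA : Extremal A) {a b c : G} (ha : a ∈ A) (hb : b ∈ A) (hc : c ∈ A)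
    (hab : a + b ∈ A) (hcab' : c + (a - b) ∈ A) (ha3 : addOrderOf a = 3) (hb3 : relOrder a b = 3)
    (hc3 : addOrderOf c = 3) (hcab : proj₂ a b c ≠ 0) : False := by
  have h3 : (3 : ℤ) • c = 0 :=
    (addOrderOf_eq_three_iff (fun h => by rw [h, addOrderOf_zero] at hc3; omega)).1 hc3
  have h0 := hA.zero_mem
  have hn := hA.neg_mem
  refine hA.three_step ha3 hb3 hc3 hcab ?_
  rintro x y z hx hy (rfl | rfl)
  · rw [zero_smul, add_zero]
    exact two_mem_reach ha hb (by omega)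
  · rcases hy with rfl | rfl | rfl
    · rw [zero_smul, add_zero]
      exact two_mem_reach ha hc (by omega)
    · rcases hx with rfl | rfl | rfl
      · exact add_mem_reach_two hb hc (by module)
      · exact add_mem_reach_two hab hc (by module)
      -- `c = -2 c`, so the target is `-c - (c + a - b)`.
      · refine add_mem_reach_two (hn _ hc) (hn _ hcab') ?_
        rw [← sub_eq_zero, ← h3]; module
    · rcases hx with rfl | rfl | rfl
      · exact add_mem_reach_two (hn _ hb) hc (by module)
      · exact add_mem_reach_two hcab' h0 (by module)
      · exact add_mem_reach_two (hn _ hab) hc (by module)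

/-- Not all nonzero elements of a subgroup of type `(3, 3)` belong to an extremal set. -/
theorem sub_notMem (hA : Extremal A) {a b : G} (ha : a ∈ A) (hb : b ∈ A) (hab : a + b ∈ A)
    (ha3 : addOrderOf a = 3) (hb3 : relOrder a b = 3) : a - b ∉ A := by
  intro hs
  have h0 := hA.zero_mem
  have hn := hA.neg_mem
  have := hA.two_step a b (n := 1) fun x y hx hy => by
    rw [ha3] at hx; rw [hb3] at hy
    apply mem_reach_of_mem
    rcases eq_of_natAbs_le_half_three hx with rfl | rfl | rfl <;>
      rcases eq_of_natAbs_le_half_three hy with rfl | rfl | rfl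
    · simpa using h0
    · simpa using hb
    · simpa using hn _ hb
    · simpa using ha
    · simpa using hab
    · simpa [sub_eq_add_neg] using hs
    · simpa using hn _ ha
    · have := hn _ hs; rw [neg_sub, sub_eq_neg_add] at this; simpa using this
    · have := hn _ hab; rw [neg_add] at this; simpa using this
  rw [ha3, hb3] at this
  omega

/-- The quotient loses exactly the largest invariant factor, whose weight pays for `±a`; all other
elements of `A` are counted in the image. -/
theorem ncard_le_of_injOn (hA : Extremal A) {a : G} (ha : a ∈ A)
    (hord : addOrderOf a = invSeq G 0)
    (hinj : ∀ b ∈ A, ∀ c ∈ A, b ∉ AddSubgroup.zmultiples a → c - b ∈ AddSubgroup.zmultiples a →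
      b = c)
    (ih : (QuotientAddGroup.mk' (AddSubgroup.zmultiples a) '' A).ncard ≤
      cardBound (G ⧸ AddSubgroup.zmultiples a)) : A.ncard ≤ cardBound G := by
  have hφ := QuotientAddGroup.mk'_surjective (AddSubgroup.zmultiples a)
  have hker := mk_zmultiples_eq_zero_iff a
  have hshift := invSeq_of_addOrderOf_eq _ hφ hker hord
  have h1 := ncard_add_one_le (A := A) (K := {0, a, -a}) (QuotientAddGroup.mk'
    (AddSubgroup.zmultiples a)) hA.zero_mem
    (fun x hx hx0 => hA.eq_of_mem_zmultiples ha hx ((hker x).1 hx0))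
    (fun b hb c hc hb0 hbc => hinj b hb c hc (fun h => hb0 ((hker b).2 h))
      ((hker _).1 (by rw [map_sub, hbc, sub_self])))
  have h2 : ({0, a, -a} : Set G).ncard ≤ 1 + weight (invSeq G 0) := by
    rw [← hord, weight]
    split_ifs with h h'
    · rw [AddMonoid.addOrderOf_eq_one_iff.1 h]; simp
    · have : -a = a := by
        rw [neg_eq_iff_add_eq_zero, ← two_nsmul, ← h']; exact addOrderOf_nsmul_eq_zero a
      rw [this, Set.pair_eq_singleton]
      exact (Set.ncard_insert_le _ _).trans (by simp)
    · refine (Set.ncard_insert_le _ _).trans ?_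
      have := Set.ncard_insert_le a {-a}
      rw [Set.ncard_singleton] at this
      omega
  have h3 := weightSum_of_shift hshift
  have h4 := threes_of_shift hshift
  rw [cardBound] at ih ⊢
  omega

/-- `A` meets `⟨a, b⟩` in at most `0, ±a, ±b, ±(a + b)`. The six nonzero elements are paid for by
two factors `3` of weight `2` each and by one further pair in `threes`. Outside `⟨a, b⟩` the
projection is injective on `A`, since a coincidence would cover a group of type `(3, 3, 3)` in two
steps. -/
theorem ncard_le_of_triple (hA : Extremal A) {a b : G} (ha : a ∈ A) (hb : b ∈ A)
    (hab : a + b ∈ A) (hba : b ∉ AddSubgroup.zmultiples a) (hG : invSeq G 0 = 3)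
    (ha3 : addOrderOf a = 3)
    (ih : (proj₂ a b '' A).ncard ≤ cardBound (Quot₂ a b)) : A.ncard ≤ cardBound G := by
  have hn := hA.neg_mem
  have h3 : ∀ x : G, (3 : ℤ) • x = 0 := by
    intro x
    have := invSeq_zero_nsmul x
    rw [hG] at this
    exact_mod_cast this
  have hord : ∀ {x : G}, x ≠ 0 → addOrderOf x = 3 := fun hx => (addOrderOf_eq_three_iff hx).2 (h3 _)
  have hb0 : b ≠ 0 := fun h => hba (h ▸ AddSubgroup.zero_mem _)
  have hab' : a ∉ AddSubgroup.zmultiples b := by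
    intro h
    rcases zmultiples_of_three (hord hb0) h with h | h | h
    · rw [h, addOrderOf_zero] at ha3; omega
    · exact hba (h ▸ AddSubgroup.mem_zmultiples a)
    · exact hba (by rw [h]; simp)
  have hb3 : relOrder a b = 3 := by
    rw [relOrder_eq_addOrderOf (hA.disjoint_zmultiples ha hb hba hab'), hord hb0]
  have hsub := hA.sub_notMem ha hb hab ha3 hb3
  have hsub' : -a + b ∉ A := fun h => hsub (by have := hn _ h; simpa [sub_eq_add_neg, add_comm])
  have hφ := QuotientAddGroup.mk'_surjective (AddSubgroup.zmultiples a)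
  have hshift := invSeq_of_addOrderOf_eq _ hφ (mk_zmultiples_eq_zero_iff a) (by rw [ha3, hG])
  have hQ : invSeq (G ⧸ AddSubgroup.zmultiples a) 0 = 3 := by
    refine Nat.dvd_antisymm ?_ ?_
    · rw [← hG]; exact invSeq_dvd_of_surjective _ hφ 0
    · rw [← hb3, relOrder]
      exact addOrderOf_dvd_iff_nsmul_eq_zero.2 (invSeq_zero_nsmul _)
  have hshift' := invSeq_of_addOrderOf_eq _ (QuotientAddGroup.mk'_surjective _)
    (mk_zmultiples_eq_zero_iff (QuotientAddGroup.mk' (AddSubgroup.zmultiples a) b))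
    (by rw [hQ]; exact hb3)
  have h1 := ncard_add_one_le (A := A) (K := {0, a, -a, b, -b, a + b, -(a + b)}) (proj₂ a b)
    hA.zero_mem
    (fun x hx hx0 => by
      have := hA.mem_span_pair ha hb hx hba hab' hx0
      simp only [Set.mem_insert_iff, Set.mem_singleton_iff]
      rcases this with h | h | h | h | h | ⟨-, -, h | h | h | h⟩
      · simp [h]
      · simp [h]
      · simp [h]
      · simp [h]
      · simp [h]
      · simp [h]
      · exact absurd (h ▸ hx) hsub
      · exact absurd (h ▸ hx) hsub'
      · right; right; right; right; right; right; rw [h]; abel)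
    (fun c hc c' hc' hc0 hcc => by
      by_contra hne
      have hcne : c ≠ 0 := fun h => hc0 (by rw [h, map_zero])
      have hc0' : proj₂ a b c' ≠ 0 := hcc ▸ hc0
      have hcne' : c' ≠ 0 := fun h => hc0' (by rw [h, map_zero])
      obtain ⟨p, q, hpq, hp, hq⟩ := exists_proj₂_rep (a := a) (b := b) (x := c' - c)
        (by rw [map_sub, hcc, sub_self])
      rw [ha3] at hp
      rw [hb3] at hq
      rw [sub_eq_iff_eq_add] at hpq
      have hsab : ∀ x, proj₂ b a x = 0 ↔ proj₂ a b x = 0 := by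
        intro x
        rw [proj₂_eq_zero_iff, proj₂_eq_zero_iff]
        exact ⟨fun ⟨m, n, h⟩ => ⟨n, m, by rw [h, add_comm]⟩,
          fun ⟨m, n, h⟩ => ⟨n, m, by rw [h, add_comm]⟩⟩
      have hra : relOrder b a = 3 := by
        rw [relOrder_eq_addOrderOf (hA.disjoint_zmultiples hb ha hab' hba), ha3]
      have hsum : ∀ x, proj₂ (-(a + b)) a x = 0 → proj₂ a b x = 0 := by
        intro x
        rw [proj₂_eq_zero_iff, proj₂_eq_zero_iff]
        rintro ⟨m, n, rfl⟩
        exact ⟨n - m, -m, by module⟩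
      have hab0 : a + b ≠ 0 := by
        intro h
        rw [add_eq_zero_iff_neg_eq] at h
        exact hba (by rw [← h]; simp)
      have hrs : relOrder (-(a + b)) a = 3 := by
        rw [relOrder_eq_addOrderOf (hA.disjoint_zmultiples (hn _ hab) ha _ _), ha3]
        · intro h
          rcases zmultiples_of_three (by rw [addOrderOf_neg]; exact hord hab0) h with h | h | h
          · rw [h, addOrderOf_zero] at ha3; omega
          · apply hba
            have : b = -(2 : ℤ) • a := by
              have h5 : b = -a - a := by
                calc b = -(-(a + b)) - a := by abel
                  _ = -a - a := by rw [← h]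
              rw [h5]; module
            rw [this]; exact ⟨_, rfl⟩
          · rw [neg_neg] at h
            exact hb0 (by simpa using h)
        · intro h
          rcases zmultiples_of_three ha3 h with h | h | h
          · exact hab0 (neg_eq_zero.1 h)
          · apply hba
            have : b = -(2 : ℤ) • a := by
              have h5 : b = -a - a := by
                calc b = -(-(a + b)) - a := by abel
                  _ = -a - a := by rw [h]
              rw [h5]; module
            rw [this]; exact ⟨_, rfl⟩
          · exact hb0 (by simpa using h)
      -- The elements `a`, `b`, `-(a + b)` sum to zero and play symmetric roles, so
      -- `not_two_triples` excludes each of them as a difference, and `not_triple_of_sub` excludes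
      -- `a - b`. Exchanging `c` and `c'` handles the other four nonzero elements of `⟨a, b⟩`.
      have main : ∀ c ∈ A, proj₂ a b c ≠ 0 → c ≠ 0 →
          c + a ∉ A ∧ c + b ∉ A ∧ c + -(a + b) ∉ A ∧ c + (a - b) ∉ A := by
        intro c hc hc0 hcne
        refine ⟨fun h => ?_, fun h => ?_, fun h => ?_, fun h => ?_⟩
        · exact hA.not_two_triples ha hb hc hab h ha3 hb3 (hord hcne) hc0
        · exact hA.not_two_triples hb ha hc (add_comm a b ▸ hab) h (hord hb0) hra (hord hcne)
            (fun h' => hc0 ((hsab c).1 h'))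
        · exact hA.not_two_triples (hn _ hab) ha hc (by simpa using hn _ hb) h
            (by rw [addOrderOf_neg]; exact hord hab0) hrs (hord hcne) (fun h' => hc0 (hsum c h'))
        · exact hA.not_triple_of_sub ha hb hc hab h ha3 hb3 (hord hcne) hc0
      obtain ⟨m1, m2, m3, m4⟩ := main c hc hc0 hcne
      obtain ⟨n1, n2, n3, n4⟩ := main c' hc' hc0' hcne'
      rcases eq_of_natAbs_le_half_three hp with rfl | rfl | rfl <;>
        rcases eq_of_natAbs_le_half_three hq with rfl | rfl | rfl
      · exact hne (by rw [hpq]; module)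
      · exact m2 (by convert hc' using 1; rw [hpq]; module)
      · exact n2 (by convert hc using 1; rw [hpq]; module)
      · exact m1 (by convert hc' using 1; rw [hpq]; module)
      · exact n3 (by convert hc using 1; rw [hpq]; module)
      · exact m4 (by convert hc' using 1; rw [hpq]; module)
      · exact n1 (by convert hc using 1; rw [hpq]; module)
      · exact n4 (by convert hc using 1; rw [hpq]; module)
      · exact m3 (by convert hc' using 1; rw [hpq]; module))
  have h2 : ({0, a, -a, b, -b, a + b, -(a + b)} : Set G).ncard ≤ 7 := by
    refine (Set.ncard_insert_le _ _).trans (Nat.succ_le_succ ?_)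
    refine (Set.ncard_insert_le _ _).trans (Nat.succ_le_succ ?_)
    refine (Set.ncard_insert_le _ _).trans (Nat.succ_le_succ ?_)
    refine (Set.ncard_insert_le _ _).trans (Nat.succ_le_succ ?_)
    refine (Set.ncard_insert_le _ _).trans (Nat.succ_le_succ ?_)
    refine (Set.ncard_insert_le _ _).trans (Nat.succ_le_succ ?_)
    simp
  have h4 := weightSum_of_shift hshift
  have h5 := threes_of_shift hshift
  have h6 := weightSum_of_shift hshift'
  have h7 := threes_of_shift hshift'
  rw [hG, if_pos rfl] at h5
  rw [hQ, if_pos rfl] at h7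
  rw [hG] at h4
  rw [hQ] at h6
  have hw : weight 3 = 2 := rfl
  rw [hw] at h4 h6
  have e1 : weightSum G = 4 + weightSum (Quot₂ a b) := by rw [h4, h6]; ring
  have e2 : threes G = 2 + threes (Quot₂ a b) := by rw [h5, h7]; ring
  rw [cardBound] at ih ⊢
  omega

end Extremal

/-- The cardinality of an extremal set is bounded in terms of the type of the group. -/
theorem Extremal.ncard_le {G : Type*} [AddCommGroup G] [Finite G] {A : Set G} (hA : Extremal A) :
    A.ncard ≤ cardBound G := by
  induction hcard : Nat.card G using Nat.strong_induction_on generalizing G with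
  | _ n ih =>
  subst hcard
  obtain ⟨a, ha, hord⟩ := hA.exists_addOrderOf_eq_invSeq
  by_cases ha0 : a = 0
  · have h1 : invSeq G 0 = 1 := by rw [← hord, ha0, addOrderOf_zero]
    have h2 : A ⊆ {0} := by
      intro x _
      have := invSeq_zero_nsmul x
      rwa [h1, one_smul] at this
    have h3 := Set.ncard_le_ncard h2 (Set.toFinite _)
    rw [Set.ncard_singleton] at h3
    rw [cardBound]; omega
  have hφ := QuotientAddGroup.mk'_surjective (AddSubgroup.zmultiples a)
  have hker := mk_zmultiples_eq_zero_iff a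
  by_cases hinj : ∀ b ∈ A, ∀ c ∈ A, b ∉ AddSubgroup.zmultiples a →
      c - b ∈ AddSubgroup.zmultiples a → b = c
  · refine hA.ncard_le_of_injOn ha hord hinj ?_
    refine ih _ (card_quotient_zmultiples_lt ha0) ?_ rfl
    exact hA.image _ hφ (fun x hx => zmultiples_subset_reach ha ((hker x).1 hx))
      (halfSum_add_le _ hφ hker)
  · push Not at hinj
    obtain ⟨b, hb, c, hc, hba, hcb, hne⟩ := hinj
    have hb0 : b ≠ 0 := fun h => hba (h ▸ AddSubgroup.zero_mem _)
    have hab : a ∉ AddSubgroup.zmultiples b := by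
      intro h
      rcases hA.eq_of_mem_zmultiples hb ha h with h | h | h
      · exact ha0 h
      · exact hba (h ▸ AddSubgroup.mem_zmultiples a)
      · exact hba (by rw [h]; simp)
    have hdisj := hA.disjoint_zmultiples ha hb hba hab
    obtain ⟨k, hk⟩ := hcb
    simp only at hk
    have hc' : c = k • a + b := by rw [hk]; abel
    -- Here `c` is a third element in the span of `a` and `b`; the case `c = -b` falls to
    -- independence, as it makes `k a = -2 b` vanish.
    have key : addOrderOf a = 3 ∧ addOrderOf b = 3 := by
      rcases hA.mem_span_pair ha hb hc hba hab
        ((proj₂_eq_zero_iff a b c).2 ⟨k, 1, by rw [one_smul, hc']⟩) with h | h | h | h | h | h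
      · exact absurd ⟨-k, by simp only; rw [neg_smul, hk, h]; abel⟩ hba
      · exact absurd ⟨1 - k, by simp only; rw [sub_smul, one_smul, hk, h]; abel⟩ hba
      · exact absurd ⟨-1 - k, by simp only; rw [sub_smul, neg_smul, one_smul, hk, h]; abel⟩ hba
      · exact absurd h.symm hne
      · exfalso
        have h1 : k • a = (-2 : ℤ) • b := by rw [hk, h]; module
        have h2 := hdisj (k • a) ⟨k, rfl⟩ ⟨-2, h1.symm⟩
        rw [hc', h2, zero_add] at hne
        exact hne rfl
      · exact ⟨h.1, h.2.1⟩
    obtain ⟨ha3, hb3⟩ := key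
    have hG : invSeq G 0 = 3 := by rw [← hord, ha3]
    have step : ∀ b ∈ A, b ∉ AddSubgroup.zmultiples a → a + b ∈ A → A.ncard ≤ cardBound G := by
      intro b hb hba hab
      refine hA.ncard_le_of_triple ha hb hab hba hG ha3 (ih _ ?_ ?_ rfl)
      · refine lt_of_le_of_lt ?_ (card_quotient_zmultiples_lt ha0)
        exact Nat.card_le_card_of_surjective _ (QuotientAddGroup.mk'_surjective _)
      · refine hA.image _ (proj₂_surjective a b) (fun x hx => ?_) (halfSum_add_two_le a b)
        obtain ⟨m, n, rfl, hm, hn⟩ := exists_proj₂_rep hx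
        exact two_mem_reach ha hb (Nat.add_le_add hm hn)
    -- The difference `c - b` is `±a`, so the triple is `a, b, c` with `c = a + b`, or `a, c, b`
    -- with `b = a + c`.
    rcases zmultiples_of_three ha3 ⟨k, hk⟩ with h | h | h
    · exact absurd (sub_eq_zero.1 h).symm hne
    · refine step b hb hba ?_
      rw [← h]; simpa using hc
    · refine step c hc ?_ ?_
      · rintro ⟨m, rfl⟩
        exact hba ⟨m + 1, by simp only at h ⊢; rw [add_smul, one_smul]; rw [sub_eq_iff_eq_add] at h; rw [h]; abel⟩
      · have : a + c = b := by rw [sub_eq_iff_eq_add] at h; rw [h]; abel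
        rw [this]; exact hb

end Counting

/-! ### Standard generating sets and integer coordinates. -/

section Standard

theorem coeAddMonoidHom_zmultiples_eq_sum {G ι : Type*} [AddCommGroup G] [Fintype ι]
    [DecidableEq ι] (b : ι → G) (x : DirectSum ι fun i => AddSubgroup.zmultiples (b i)) :
    DirectSum.coeAddMonoidHom (fun i => AddSubgroup.zmultiples (b i)) x = ∑ i, (x i : G) := by
  classical
  rw [DirectSum.coeAddMonoidHom_eq_dfinsuppSum, DFinsupp.sum_eq_sum_fintype _ fun _ => rfl]
  rfl

theorem dvd_of_sum_zsmul_eq_zero {G ι : Type*} [AddCommGroup G] [Fintype ι] [DecidableEq ι]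
    {b : ι → G} (hb : DirectSum.IsInternal fun i => AddSubgroup.zmultiples (b i)) {z : ι → ℤ}
    (hz : ∑ i, z i • b i = 0) (i : ι) : (addOrderOf (b i) : ℤ) ∣ z i := by
  let x : DirectSum ι fun i => AddSubgroup.zmultiples (b i) :=
    DFinsupp.equivFunOnFintype.symm fun i => ⟨z i • b i, z i, rfl⟩
  have hx : ∀ i, (x i : G) = z i • b i := fun i => rfl
  have h0 : x = 0 := by
    apply hb.1
    rw [coeAddMonoidHom_zmultiples_eq_sum, map_zero, ← hz]
    exact Finset.sum_congr rfl fun i _ => hx i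
  rw [addOrderOf_dvd_iff_zsmul_eq_zero, ← hx, h0]
  rfl

theorem exists_eq_sum_zsmul {G ι : Type*} [AddCommGroup G] [Fintype ι] [DecidableEq ι]
    {b : ι → G} (hb : DirectSum.IsInternal fun i => AddSubgroup.zmultiples (b i)) (g : G) :
    ∃ z : ι → ℤ, g = ∑ i, z i • b i := by
  obtain ⟨x, rfl⟩ := hb.2 g
  choose z hz using fun i => (x i).2
  refine ⟨z, ?_⟩
  rw [coeAddMonoidHom_zmultiples_eq_sum]
  exact Finset.sum_congr rfl fun i _ => (hz i).symm

theorem isInternal_zmultiples {G ι : Type*} [AddCommGroup G] [Fintype ι] [DecidableEq ι]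
    {b : ι → G} (hgen : ∀ g, ∃ z : ι → ℤ, g = ∑ i, z i • b i)
    (hind : ∀ z : ι → ℤ, ∑ i, z i • b i = 0 → ∀ i, z i • b i = 0) :
    DirectSum.IsInternal fun i => AddSubgroup.zmultiples (b i) := by
  constructor
  · rw [injective_iff_map_eq_zero]
    intro x hx
    choose z hz using fun i => (x i).2
    simp only at hz
    rw [coeAddMonoidHom_zmultiples_eq_sum] at hx
    have := hind z (by rw [← hx]; exact Finset.sum_congr rfl fun i _ => hz i)
    ext i
    rw [← hz, this]
    rfl
  · intro g
    obtain ⟨z, rfl⟩ := hgen g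
    refine ⟨DFinsupp.equivFunOnFintype.symm fun i => ⟨z i • b i, z i, rfl⟩, ?_⟩
    rw [coeAddMonoidHom_zmultiples_eq_sum]
    rfl

theorem exists_isStandardGenerating (G : Type*) [AddCommGroup G] [Finite G] :
    ∃ b : Fin (rk G) → G, IsStandardGenerating b := by
  obtain ⟨e⟩ := (isOfType_invFactor G).2.2
  have hord : ∀ i, addOrderOf (e.symm (Pi.single i 1)) = invFactor G i := by
    intro i
    rw [AddEquiv.addOrderOf_eq]
    exact (addOrderOf_injective (AddMonoidHom.single (fun i => ZMod (invFactor G i)) i)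
      (fun a b h => Pi.single_injective (M := fun i => ZMod (invFactor G i)) i h) 1).trans
        (ZMod.addOrderOf_one _)
  have hsum : ∀ z : Fin (rk G) → ℤ,
      e (∑ i, z i • e.symm (Pi.single i 1)) = fun i => (z i : ZMod (invFactor G i)) := by
    intro z
    rw [map_sum]
    ext j
    rw [Finset.sum_apply, Finset.sum_eq_single j]
    · simp
    · intro i _ hij
      simp [Ne.symm hij]
    · simp
  refine ⟨fun i => e.symm (Pi.single i 1), isInternal_zmultiples ?_ ?_, hord⟩
  · intro g
    choose z hz using fun i => ZMod.intCast_surjective (e g i)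
    refine ⟨z, e.injective ?_⟩
    rw [hsum]
    ext i
    exact (hz i).symm
  · intro z hz i
    have h := hsum z
    rw [hz, map_zero] at h
    rw [← addOrderOf_dvd_iff_zsmul_eq_zero, hord, ← ZMod.intCast_zmod_eq_zero_iff_dvd]
    exact (congrFun h i).symm

/-- Elements covered in `n` steps by a family are integer combinations of weight at most `n`. -/
theorem exists_coeff_of_mem_reach {G ι : Type*} [AddCommGroup G] [Fintype ι] [DecidableEq ι]
    {e : ι → G} {n : ℕ} {x : G} (hx : x ∈ reach (Set.range e) n) :
    ∃ u : ι → ℤ, x = ∑ s, u s • e s ∧ ∑ s, |u s| ≤ n := by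
  obtain ⟨a, ha, rfl⟩ := hx
  have h1 : ∀ i, ∃ w : ι → ℤ, a i = ∑ s, w s • e s ∧ ∑ s, |w s| ≤ 1 := by
    intro i
    have single : ∀ (t : ι) (k : ℤ), |k| ≤ 1 → a i = k • e t →
        ∃ w : ι → ℤ, a i = ∑ s, w s • e s ∧ ∑ s, |w s| ≤ 1 := by
      intro t k hk h
      refine ⟨Pi.single t k, ?_, ?_⟩
      · rw [Finset.sum_eq_single t] <;> simp +contextual [h]
      · rw [Finset.sum_eq_single t] <;> simp +contextual [hk]
    rcases mem_symmClosure.1 (ha i) with ⟨t, h⟩ | h | ⟨t, h⟩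
    · exact single t (-1) (by simp) (by rw [h]; simp)
    · exact ⟨0, by simp [h], by simp⟩
    · exact single t 1 (by simp) (by rw [h]; simp)
  choose w hw hw1 using h1
  refine ⟨fun s => ∑ i, w i s, ?_, ?_⟩
  · simp only [Finset.sum_smul]
    rw [Finset.sum_comm]
    exact Finset.sum_congr rfl fun i _ => hw i
  · calc ∑ s, |∑ i, w i s| ≤ ∑ s, ∑ i, |w i s| :=
        Finset.sum_le_sum fun s _ => Finset.abs_sum_le_sum_abs _ _
      _ = ∑ i, ∑ s, |w i s| := Finset.sum_comm
      _ ≤ ∑ _i : Fin n, 1 := Finset.sum_le_sum fun i _ => hw1 i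
      _ = n := by simp

/-! ### The extremal set of a standard generating set. -/

section Blocks

variable (G : Type*) [AddCommGroup G] [Finite G]

theorem nu_le_rk (k : ℕ) : nu G k ≤ rk G := by
  have := Finset.card_filter_le (Finset.univ : Finset (Fin (rk G))) (fun i => invFactor G i = k)
  simpa [nu] using this

/-- The invariant factors equal to `3` come first. -/
theorem invFactor_eq_three {i : Fin (rk G)} (hi : (i : ℕ) < nu G 3) : invFactor G i = 3 := by
  by_contra h
  have hsub : (Finset.univ.filter fun j => invFactor G j = 3) ⊆ Finset.Iio i := by
    intro j hj
    rw [Finset.mem_filter] at hj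
    rw [Finset.mem_Iio]
    by_contra hij
    have hd := (isOfType_invFactor G).2.1 i j (not_lt.1 hij)
    rw [hj.2, Nat.dvd_prime Nat.prime_three] at hd
    have := (isOfType_invFactor G).1 i
    omega
  have := Finset.card_le_card hsub
  rw [Fin.card_Iio] at this
  rw [nu] at hi
  omega

/-- The index sets of the sums of basis elements in the extremal set. -/
noncomputable def block : Fin (rk G) ⊕ Fin (nu G 3 / 2) → Finset (Fin (rk G))
  | .inl i => {i}
  | .inr j => Finset.univ.filter fun i => (i : ℕ) / 2 = j

variable {G}

theorem mem_block_inl {i i' : Fin (rk G)} : i ∈ block G (.inl i') ↔ i = i' := by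
  simp [block]

theorem mem_block_inr {i : Fin (rk G)} {j : Fin (nu G 3 / 2)} :
    i ∈ block G (.inr j) ↔ (i : ℕ) / 2 = j := by
  simp [block]

theorem block_inr_eq (j : Fin (nu G 3 / 2)) (k l : Fin (rk G)) (hk : (k : ℕ) = 2 * j)
    (hl : (l : ℕ) = 2 * j + 1) : block G (.inr j) = {k, l} := by
  ext i
  rw [mem_block_inr, Finset.mem_insert, Finset.mem_singleton, Fin.ext_iff, Fin.ext_iff, hk, hl]
  omega

theorem exists_pair (j : Fin (nu G 3 / 2)) :
    ∃ k l : Fin (rk G), (k : ℕ) = 2 * j ∧ (l : ℕ) = 2 * j + 1 := by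
  have := nu_le_rk G 3
  exact ⟨⟨2 * j, by omega⟩, ⟨2 * j + 1, by omega⟩, rfl, rfl⟩

theorem block_nonempty (s : Fin (rk G) ⊕ Fin (nu G 3 / 2)) : (block G s).Nonempty := by
  rcases s with i | j
  · exact ⟨i, mem_block_inl.2 rfl⟩
  · obtain ⟨k, l, hk, hl⟩ := exists_pair j
    exact ⟨k, mem_block_inr.2 (by omega)⟩

theorem block_injective : Function.Injective (block G) := by
  have hne : ∀ (i : Fin (rk G)) (j : Fin (nu G 3 / 2)), block G (.inl i) ≠ block G (.inr j) := by
    intro i j h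
    obtain ⟨k, l, hk, hl⟩ := exists_pair j
    have h1 : k ∈ block G (.inl i) := h ▸ mem_block_inr.2 (by omega)
    have h2 : l ∈ block G (.inl i) := h ▸ mem_block_inr.2 (by omega)
    rw [mem_block_inl] at h1 h2
    rw [h1] at hk
    rw [h2] at hl
    omega
  rintro (i | j) (i' | j') h
  · exact congrArg _ (mem_block_inl.1 (h ▸ mem_block_inl.2 rfl))
  · exact absurd h (hne i j')
  · exact absurd h.symm (hne i' j)
  · obtain ⟨k, l, hk, hl⟩ := exists_pair j
    have h1 : k ∈ block G (.inr j') := h ▸ mem_block_inr.2 (by omega)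
    rw [mem_block_inr] at h1
    congr 1
    ext
    omega

/-- The sums of basis elements in the extremal set. -/
noncomputable def blockSum (b : Fin (rk G) → G) (s : Fin (rk G) ⊕ Fin (nu G 3 / 2)) : G := ∑ i ∈ block G s, b i

theorem extremalSet_eq (b : Fin (rk G) → G) :
    extremalSet b = symmClosure (Set.range (blockSum b)) := by
  rw [extremalSet]
  congr 1
  have hinl : ∀ i, blockSum b (.inl i) = b i := fun i => by simp [blockSum, block]
  have hinr : ∀ (j : Fin (nu G 3 / 2)) (k l : Fin (rk G)), (k : ℕ) = 2 * j → (l : ℕ) = 2 * j + 1 →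
      blockSum b (.inr j) = b k + b l := by
    intro j k l hk hl
    rw [blockSum, block_inr_eq j k l hk hl, Finset.sum_pair]
    intro h
    rw [h] at hk
    omega
  ext g
  constructor
  · rintro (⟨i, rfl⟩ | ⟨k, l, hk, hl, hk3, rfl⟩)
    · exact ⟨.inl i, hinl i⟩
    · obtain ⟨c, hc⟩ := hk
      exact ⟨.inr ⟨c, by omega⟩, hinr _ k l (by simp; omega) (by simp; omega)⟩
  · rintro ⟨i | j, rfl⟩
    · exact Or.inl ⟨i, (hinl i).symm⟩
    · obtain ⟨k, l, hk, hl⟩ := exists_pair j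
      exact Or.inr ⟨k, l, ⟨j, by omega⟩, by omega, by omega, hinr j k l hk hl⟩

variable {b : Fin (rk G) → G}

theorem IsStandardGenerating.dvd (hb : IsStandardGenerating b) {z : Fin (rk G) → ℤ}
    (hz : ∑ i, z i • b i = 0) (i : Fin (rk G)) : (invFactor G i : ℤ) ∣ z i := by
  rw [← hb.2 i]
  exact dvd_of_sum_zsmul_eq_zero hb.1 hz i

theorem sum_eq_sum_ite (S : Finset (Fin (rk G))) :
    ∑ i ∈ S, b i = ∑ i, (if i ∈ S then (1 : ℤ) else 0) • b i := by
  simp [ite_smul, Finset.sum_ite_mem]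

/-- At an index in exactly one of `S` and `T` the coefficient of the relation is `±1`, which no `mᵢ
> 1` divides. -/
theorem IsStandardGenerating.eq_of_sum_eq (hb : IsStandardGenerating b) {S T : Finset (Fin (rk G))}
    {ε : ℤ} (hε : ε = 1 ∨ ε = -1) (h : ∑ i ∈ S, b i = ε • ∑ i ∈ T, b i) : S = T := by
  have hz : ∑ i, ((if i ∈ S then (1 : ℤ) else 0) - ε * (if i ∈ T then (1 : ℤ) else 0)) • b i = 0 := by
    simp only [sub_smul, Finset.sum_sub_distrib, mul_smul]
    rw [← sum_eq_sum_ite, ← Finset.smul_sum, ← sum_eq_sum_ite, h, sub_self]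
  ext i
  have hd := hb.dvd hz i
  have hm := (isOfType_invFactor G).1 i
  by_contra hne
  have h1 : (invFactor G i : ℤ) ∣ 1 := by
    by_cases hS : i ∈ S <;> by_cases hT : i ∈ T
    · exact absurd ⟨fun _ => hT, fun _ => hS⟩ hne
    · simpa [hS, hT] using hd
    · rcases hε with rfl | rfl <;> simpa [hS, hT] using hd
    · exact absurd ⟨fun h => absurd h hS, fun h => absurd h hT⟩ hne
  have := Int.le_of_dvd one_pos h1
  omega

theorem IsStandardGenerating.eq_of_blockSum_eq (hb : IsStandardGenerating b)
    {s t : Fin (rk G) ⊕ Fin (nu G 3 / 2)}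
    (h : blockSum b s = blockSum b t ∨ blockSum b s = -blockSum b t) : s = t := by
  apply block_injective
  rcases h with h | h
  · exact hb.eq_of_sum_eq (Or.inl rfl) (by rw [one_smul]; exact h)
  · exact hb.eq_of_sum_eq (Or.inr rfl) (by rw [neg_smul, one_smul]; exact h)

theorem IsStandardGenerating.blockSum_ne_zero (hb : IsStandardGenerating b)
    (s : Fin (rk G) ⊕ Fin (nu G 3 / 2)) : blockSum b s ≠ 0 := by
  intro h
  have := hb.eq_of_sum_eq (S := block G s) (T := ∅) (Or.inl rfl) (by simpa [blockSum] using h)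
  exact (block_nonempty s).ne_empty this

theorem IsStandardGenerating.dvd_two_of_blockSum_eq_neg (hb : IsStandardGenerating b)
    {s : Fin (rk G) ⊕ Fin (nu G 3 / 2)} (h : blockSum b s = -blockSum b s) {i : Fin (rk G)}
    (hi : i ∈ block G s) : invFactor G i ∣ 2 := by
  have hz : ∑ i, ((if i ∈ block G s then (1 : ℤ) else 0) + (if i ∈ block G s then (1 : ℤ) else 0))
      • b i = 0 := by
    simp only [add_smul, Finset.sum_add_distrib]
    rw [← sum_eq_sum_ite]
    exact eq_neg_iff_add_eq_zero.1 h
  have := hb.dvd hz i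
  rw [if_pos hi] at this
  exact_mod_cast this

theorem weightSum_eq : weightSum G = ∑ i, weight (invFactor G i) := by
  rw [weightSum, Finset.sum_range]
  exact Fintype.sum_equiv Fin.revPerm _ _ fun i => by
    rw [Fin.revPerm_apply, ← invSeq_rev, Fin.rev_rev]

theorem halfSum_eq_sum_invFactor : halfSum G = ∑ i, invFactor G i / 2 := by
  rw [halfSum, Finset.sum_range]
  exact Fintype.sum_equiv Fin.revPerm _ _ fun i => by
    rw [Fin.revPerm_apply, ← invSeq_rev, Fin.rev_rev]

theorem threes_eq_nu : threes G = nu G 3 := by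
  rw [threes, Finset.sum_range, nu, Finset.card_filter]
  exact Fintype.sum_equiv Fin.revPerm _ _ fun i => by
    rw [Fin.revPerm_apply, ← invSeq_rev, Fin.rev_rev]

/-- Each invariant factor has weight `2`, or `1` if it equals `2`; so `weightSum G + nu G 2 = 2 * rk
G`, and the truncated subtraction is exact. -/
theorem cardBound_eq : cardBound G = 1 + 2 * rk G - nu G 2 + 2 * (nu G 3 / 2) := by
  have h : weightSum G + nu G 2 = 2 * rk G := by
    rw [weightSum_eq, nu, Finset.card_filter, ← Finset.sum_add_distrib]
    have : ∀ i, weight (invFactor G i) + (if invFactor G i = 2 then 1 else 0) = 2 := by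
      intro i
      have := (isOfType_invFactor G).1 i
      rw [weight, if_neg (by omega)]
      split_ifs <;> rfl
    simp [this, mul_comm]
  rw [cardBound, threes_eq_nu]
  omega

/-- The sets `{±blockSum b s}` are pairwise disjoint, avoid `0`, and have two elements unless `s` is
a single index with `mᵢ = 2`. -/
theorem IsStandardGenerating.cardBound_le (hb : IsStandardGenerating b) :
    cardBound G ≤ (extremalSet b).ncard := by
  classical
  let P : Fin (rk G) ⊕ Fin (nu G 3 / 2) → Finset G := fun s => {blockSum b s, -blockSum b s}
  let F : Finset G := insert 0 (Finset.univ.biUnion P)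
  have hF : (F : Set G) ⊆ extremalSet b := by
    intro x hx
    rw [extremalSet_eq, mem_symmClosure]
    simp only [F, P, Finset.coe_insert, Finset.coe_biUnion, Set.mem_insert_iff, Set.mem_iUnion,
      Finset.coe_singleton, Set.mem_singleton_iff, Finset.mem_coe, Finset.mem_univ] at hx
    rcases hx with h | ⟨s, -, h | h⟩
    · exact Or.inr (Or.inl h)
    · exact Or.inr (Or.inr ⟨s, h.symm⟩)
    · exact Or.inl ⟨s, by rw [h, neg_neg]⟩
  have hdisj : ((Finset.univ : Finset (Fin (rk G) ⊕ Fin (nu G 3 / 2))) : Set _).PairwiseDisjoint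
      P := by
    intro s _ t _ hst
    rw [Function.onFun, Finset.disjoint_left]
    intro x hx hx'
    simp only [P, Finset.mem_insert, Finset.mem_singleton] at hx hx'
    apply hst
    apply hb.eq_of_blockSum_eq
    rcases hx with rfl | rfl
    · exact hx'
    · rcases hx' with h | h
      · exact Or.inr (by rw [← h, neg_neg])
      · exact Or.inl (neg_injective h)
  have h0 : (0 : G) ∉ Finset.univ.biUnion P := by
    simp only [P, Finset.mem_biUnion, Finset.mem_insert, Finset.mem_singleton, not_exists, not_and,
      not_or]
    intro s _
    exact ⟨(hb.blockSum_ne_zero s).symm, fun h => hb.blockSum_ne_zero s (neg_eq_zero.1 h.symm)⟩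
  have hcard : F.card = 1 + ∑ s, (P s).card := by
    rw [Finset.card_insert_of_notMem h0, Finset.card_biUnion (fun s hs t ht => hdisj hs ht), add_comm]
  have hpair : ∀ s, ¬ blockSum b s = -blockSum b s → (P s).card = 2 :=
    fun s h => Finset.card_pair h
  have hle : cardBound G ≤ F.card := by
    rw [hcard, Fintype.sum_sum_type, cardBound, weightSum_eq, threes_eq_nu, add_assoc]
    refine Nat.add_le_add_left (Nat.add_le_add (Finset.sum_le_sum fun i _ => ?_) ?_) 1
    · rw [weight, if_neg ((isOfType_invFactor G).1 i).ne']
      split_ifs with h2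
      · exact Finset.card_pos.2 ⟨_, Finset.mem_insert_self _ _⟩
      · rw [hpair]
        intro h
        have := hb.dvd_two_of_blockSum_eq_neg h (mem_block_inl.2 rfl)
        exact h2 (((Nat.dvd_prime Nat.prime_two).1 this).resolve_left
          ((isOfType_invFactor G).1 i).ne')
    · have : ∀ j : Fin (nu G 3 / 2), (P (.inr j)).card = 2 := by
        intro j
        apply hpair
        intro h
        obtain ⟨k, l, hk, hl⟩ := exists_pair j
        have := hb.dvd_two_of_blockSum_eq_neg h (mem_block_inr.2 (by omega : (k : ℕ) / 2 = j))
        rw [invFactor_eq_three G (by omega)] at this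
        omega
      simp [this, mul_comm]
  refine hle.trans ?_
  rw [← Set.ncard_coe_finset]
  exact Set.ncard_le_ncard hF (Set.toFinite _)

theorem sum_range_two_mul (f : ℕ → ℤ) (n : ℕ) :
    ∑ i ∈ Finset.range (2 * n), f i = ∑ j ∈ Finset.range n, (f (2 * j) + f (2 * j + 1)) := by
  induction n with
  | zero => simp
  | succ n ih =>
    rw [Nat.mul_succ, Finset.sum_range_succ, Finset.sum_range_succ, ih, Finset.sum_range_succ]
    ring

theorem half_le_abs_of_dvd {m : ℕ} {u : ℤ}
    (h : (m : ℤ) ∣ u - (m / 2 : ℕ) ∨ (m : ℤ) ∣ u + (m / 2 : ℕ)) : ((m / 2 : ℕ) : ℤ) ≤ |u| := by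
  by_contra! hlt
  have hu := abs_lt.1 hlt
  rcases h with h | h
  · have := Int.eq_zero_of_abs_lt_dvd h (by rw [abs_lt]; omega)
    omega
  · have := Int.eq_zero_of_abs_lt_dvd h (by rw [abs_lt]; omega)
    omega

/-- The sum of the `± ⌊mᵢ / 2⌋ bᵢ` with alternating signs is at distance at least the sum of the
`⌊mᵢ / 2⌋` from the origin. -/
theorem IsStandardGenerating.halfSum_le (hb : IsStandardGenerating b) {n : ℕ}
    (hn : reach (extremalSet b) n = Set.univ) : halfSum G ≤ n := by
  rw [extremalSet_eq, reach_symmClosure] at hn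
  -- Within a pair of order `3` the target is `b_k - b_l`; the opposite signs make the extra
  -- generator `b_k + b_l` useless.
  let τ : Fin (rk G) → ℤ := fun i =>
    if (i : ℕ) % 2 = 0 then ((invFactor G i / 2 : ℕ) : ℤ) else -((invFactor G i / 2 : ℕ) : ℤ)
  obtain ⟨u, hu, hun⟩ := exists_coeff_of_mem_reach
    (hn ▸ Set.mem_univ (∑ i, τ i • b i) : _ ∈ reach (Set.range (blockSum b)) n)
  have hr := nu_le_rk G 3
  let U : ℕ → ℤ := fun i => if hi : i < rk G then u (.inl ⟨i, hi⟩) else 0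
  let V : ℕ → ℤ := fun j => if hj : j < (nu G 3 / 2) then u (.inr ⟨j, hj⟩) else 0
  let M : ℕ → ℕ := fun i => if hi : i < rk G then invFactor G ⟨i, hi⟩ else 1
  have hcoef : ∀ i : Fin (rk G),
      (invFactor G i : ℤ) ∣ (U i + if (i : ℕ) < 2 * (nu G 3 / 2) then V (i / 2) else 0) - τ i := by
    have e : ∑ i : Fin (rk G), ((U i + if (i : ℕ) < 2 * (nu G 3 / 2) then V (i / 2) else 0) - τ i) • b i = 0 := by
      simp only [sub_smul, Finset.sum_sub_distrib]
      rw [hu, sub_eq_zero, Fintype.sum_sum_type]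
      simp only [add_smul, Finset.sum_add_distrib]
      congr 1
      · refine Finset.sum_congr rfl fun i _ => ?_
        simp [U, blockSum, block]
      · have : ∀ j : Fin (nu G 3 / 2), u (.inr j) • blockSum b (.inr j) =
            ∑ i : Fin (rk G), if (i : ℕ) / 2 = j then u (.inr j) • b i else 0 := by
          intro j
          rw [blockSum, block, Finset.smul_sum, Finset.sum_filter]
        rw [Finset.sum_congr rfl fun j _ => this j, Finset.sum_comm]
        refine Finset.sum_congr rfl fun i _ => ?_
        by_cases hi : (i : ℕ) < 2 * (nu G 3 / 2)
        · rw [if_pos hi, Finset.sum_eq_single ⟨(i : ℕ) / 2, by omega⟩]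
          · have h2 : (i : ℕ) / 2 < (nu G 3 / 2) := by omega
            simp [V, h2]
          · intro j _ hj
            rw [if_neg]
            intro hij
            exact hj (Fin.ext hij.symm)
          · simp
        · rw [if_neg hi, zero_smul, Finset.sum_eq_zero]
          intro j _
          rw [if_neg]
          omega
    exact hb.dvd e
  have hUV : ∑ i ∈ Finset.range (rk G), |U i| + ∑ j ∈ Finset.range (nu G 3 / 2), |V j| ≤ n := by
    rw [Fintype.sum_sum_type] at hun
    rw [Finset.sum_range, Finset.sum_range]
    convert hun using 2
    · refine Finset.sum_congr rfl fun i _ => ?_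
      simp [U]
    · refine Finset.sum_congr rfl fun i _ => ?_
      simp [V]
  have hM : (halfSum G : ℤ) = ∑ i ∈ Finset.range (rk G), ((M i / 2 : ℕ) : ℤ) := by
    rw [halfSum_eq_sum_invFactor, Finset.sum_range]
    push_cast
    refine Finset.sum_congr rfl fun i _ => ?_
    simp [M]
  have h2r : 2 * (nu G 3 / 2) ≤ rk G := by omega
  -- The congruences `U_k + V ≡ 1` and `U_l + V ≡ -1` modulo `3` force `|U_k| + |U_l| + |V| ≥ 2`:
  -- `V` alone cannot satisfy both.
  have hpairs : ∀ j ∈ Finset.range (nu G 3 / 2),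
      ((M (2 * j) / 2 : ℕ) : ℤ) + ((M (2 * j + 1) / 2 : ℕ) : ℤ) ≤
        |U (2 * j)| + |U (2 * j + 1)| + |V j| := by
    intro j hj
    rw [Finset.mem_range] at hj
    have hk : 2 * j < rk G := by omega
    have hl : 2 * j + 1 < rk G := by omega
    have mk : invFactor G ⟨2 * j, hk⟩ = 3 := invFactor_eq_three G (by simp only; omega)
    have ml : invFactor G ⟨2 * j + 1, hl⟩ = 3 := invFactor_eq_three G (by simp only; omega)
    have ck := hcoef ⟨2 * j, hk⟩
    have cl := hcoef ⟨2 * j + 1, hl⟩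
    simp only [τ, mk, ml] at ck cl
    rw [if_pos (by omega), if_pos (by omega), show 2 * j / 2 = j by omega] at ck
    rw [if_pos (by omega), if_neg (by omega), show (2 * j + 1) / 2 = j by omega] at cl
    simp only [M, dif_pos hk, dif_pos hl, mk, ml]
    norm_num at ck cl ⊢
    simp only [abs_eq_max_neg]
    omega
  -- No pair touches these indices, so `U i` alone is congruent to `±⌊mᵢ / 2⌋` modulo `mᵢ`.
  have hrest : ∀ i ∈ Finset.Ico (2 * (nu G 3 / 2)) (rk G), ((M i / 2 : ℕ) : ℤ) ≤ |U i| := by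
    intro i hi
    rw [Finset.mem_Ico] at hi
    have c := hcoef ⟨i, hi.2⟩
    simp only [τ] at c
    rw [if_neg (by omega), add_zero] at c
    simp only [M, dif_pos hi.2]
    refine half_le_abs_of_dvd ?_
    split_ifs at c
    · exact Or.inl c
    · exact Or.inr (by simpa using c)
  have s1 := (Finset.sum_le_sum hpairs).trans_eq Finset.sum_add_distrib
  have s2 := Finset.sum_le_sum hrest
  rw [← sum_range_two_mul (fun i => |U i|),
    ← sum_range_two_mul (fun i => ((M i / 2 : ℕ) : ℤ))] at s1
  rw [← Finset.sum_range_add_sum_Ico _ h2r] at hUV hM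
  have : (halfSum G : ℤ) ≤ n := by linarith
  exact_mod_cast this

theorem IsStandardGenerating.closure_extremalSet (hb : IsStandardGenerating b) :
    AddSubgroup.closure (extremalSet b) = ⊤ := by
  rw [eq_top_iff]
  intro g _
  obtain ⟨z, rfl⟩ := exists_eq_sum_zsmul hb.1 g
  refine sum_mem fun i _ => zsmul_mem (AddSubgroup.subset_closure ?_) _
  exact subset_symmClosure (Or.inl ⟨i, rfl⟩)

theorem IsStandardGenerating.extremal (hb : IsStandardGenerating b) : Extremal (extremalSet b) where
  closure_eq := hb.closure_extremalSet
  zero_mem := zero_mem_symmClosure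
  neg_mem _ := neg_mem_symmClosure
  le _ := hb.halfSum_le

end Blocks

/-! ### Aperiodicity, maximality and the values of the invariants. -/

/-- Extremal sets are aperiodic: factoring out a period does not change the diameter, unless the
quotient is trivial. -/
theorem Extremal.aperiodic {G : Type*} [AddCommGroup G] [Finite G] {A : Set G} (hA : Extremal A)
    (h2 : 2 ≤ halfSum G) : Aperiodic A := by
  rw [Aperiodic, eq_bot_iff]
  intro g hg
  by_contra hg0
  have hle : AddSubgroup.zmultiples g ≤ AddAction.stabilizer G A :=
    AddSubgroup.zmultiples_le_of_mem hg
  set φ := QuotientAddGroup.mk' (AddSubgroup.zmultiples g) with hφdef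
  have hφ : Function.Surjective φ := QuotientAddGroup.mk'_surjective _
  have hker := mk_zmultiples_eq_zero_iff g
  have h1 := halfSum_add_le φ hφ hker
  have hord : 2 ≤ addOrderOf g := Extremal.two_le_addOrderOf hg0
  have hQ := reach_halfSum (closure_image_eq_top hA.closure_eq φ hφ)
  have hQ' : reach (φ '' A) (halfSum (G ⧸ AddSubgroup.zmultiples g) + 1) = Set.univ :=
    Set.eq_univ_of_univ_subset (hQ ▸ reach_mono (Nat.le_succ _))
  -- The error of a lifted sum is a period of `A`, so it is absorbed into one summand; hence at
  -- least one summand is required.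
  have key : ∀ n, reach (φ '' A) (n + 1) = Set.univ → reach A (n + 1) = Set.univ := by
    intro n hn
    refine Set.eq_univ_of_forall fun x => ?_
    obtain ⟨y, hy, hxy⟩ := exists_lift_mem_reach φ
      (hn ▸ Set.mem_univ (φ x) : φ x ∈ reach (φ '' A) (n + 1))
    obtain ⟨s, hs, y', hy', rfl⟩ := reach_succ_exists hy
    rw [symmClosure_eq_self hA.zero_mem hA.neg_mem] at hs
    have hmem : x - (s + y') ∈ AddAction.stabilizer G A :=
      hle ((hker _).1 (by rw [map_sub, hxy, sub_self]))
    have hs' : (x - (s + y')) + s ∈ A := by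
      have := Set.vadd_mem_vadd_set (a := x - (s + y')) hs
      rw [AddAction.mem_stabilizer_iff.1 hmem] at this
      exact this
    have := add_mem_reach (mem_reach_of_mem hs') hy'
    rw [add_comm 1 n] at this
    convert this using 1
    abel
  -- For a quotient with `halfSum` zero one step would suffice, against `2 ≤ halfSum G`; otherwise
  -- `halfSum` of the quotient would suffice, which is smaller by at least `⌊ord g / 2⌋ ≥ 1`.
  rcases Nat.eq_zero_or_pos (halfSum (G ⧸ AddSubgroup.zmultiples g)) with h0 | hpos
  · have := hA.le _ (key _ hQ')
    omega
  · obtain ⟨n, hn⟩ := Nat.exists_eq_succ_of_ne_zero hpos.ne'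
    rw [hn] at hQ
    have := hA.le _ (key n hQ)
    omega

variable {G : Type*} [AddCommGroup G] [Finite G]

theorem diamWith_le_halfSum {A : Set G} (hA : AddSubgroup.closure A = ⊤) :
    diamWith A ≤ halfSum G := diamWith_le (reach_halfSum hA)

theorem absDiam_eq_halfSum : absDiam G = halfSum G := by
  obtain ⟨b, hb⟩ := exists_isStandardGenerating G
  refine IsGreatest.csSup_eq ⟨⟨extremalSet b, hb.closure_extremalSet, ?_⟩, ?_⟩
  · exact le_antisymm (diamWith_le_halfSum hb.closure_extremalSet)
      (le_diamWith_iff.2 fun n => hb.halfSum_le)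
  · rintro d ⟨A, hA, hd⟩
    have := diamWith_le_halfSum hA
    rw [hd] at this
    exact_mod_cast this

/-- The cardinality bound for all generating sets of maximal diameter. -/
theorem ncard_le_cardBound {A : Set G} (hA : AddSubgroup.closure A = ⊤)
    (h : (halfSum G : ℕ∞) ≤ diamWith A) : A.ncard ≤ cardBound G := by
  have hE : Extremal (symmClosure A) :=
    { closure_eq := eq_top_iff.2 (hA ▸ AddSubgroup.closure_mono subset_symmClosure)
      zero_mem := zero_mem_symmClosure
      neg_mem := fun _ => neg_mem_symmClosure
      le := fun n hn => le_diamWith_iff.1 h n (by rwa [reach_symmClosure] at hn) }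
  exact (Set.ncard_le_ncard subset_symmClosure (Set.toFinite _)).trans hE.ncard_le

theorem IsStandardGenerating.ncard_extremalSet {b : Fin (rk G) → G} (hb : IsStandardGenerating b) :
    (extremalSet b).ncard = cardBound G :=
  le_antisymm hb.extremal.ncard_le hb.cardBound_le

theorem IsStandardGenerating.halfSum_le_diamWith {b : Fin (rk G) → G}
    (hb : IsStandardGenerating b) : (halfSum G : ℕ∞) ≤ diamWith (extremalSet b) :=
  le_diamWith_iff.2 fun _ => hb.halfSum_le

/-- A larger set still generates, so the cardinality bound applies to it, and the extremal set
already attains that bound. -/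
theorem IsStandardGenerating.rhoMaximal {b : Fin (rk G) → G} (hb : IsStandardGenerating b) :
    RhoMaximal (halfSum G) (extremalSet b) := by
  refine ⟨hb.halfSum_le_diamWith, fun B hB hle => ?_⟩
  have hclos : AddSubgroup.closure B = ⊤ :=
    eq_top_iff.2 (hb.closure_extremalSet ▸ AddSubgroup.closure_mono hle)
  have h1 := ncard_le_cardBound hclos hB
  rw [← hb.ncard_extremalSet] at h1
  exact (Set.eq_of_subset_of_ncard_le hle h1 (Set.toFinite _)).ge

theorem sInvariant_halfSum : sInvariant G (halfSum G) = cardBound G := by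
  obtain ⟨b, hb⟩ := exists_isStandardGenerating G
  refine IsGreatest.csSup_eq ⟨⟨extremalSet b, hb.halfSum_le_diamWith, ?_, hb.ncard_extremalSet⟩, ?_⟩
  · exact (diamWith_le_halfSum hb.closure_extremalSet).trans_lt (ENat.natCast_lt_top _)
  · rintro n ⟨A, hA, hA', rfl⟩
    obtain ⟨k, hk⟩ := exists_reach_of_diamWith_lt_top hA'
    exact ncard_le_cardBound (closure_eq_top_of_reach hk) hA

theorem tInvariant_halfSum (h2 : 2 ≤ halfSum G) : tInvariant G (halfSum G) = cardBound G := by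
  obtain ⟨b, hb⟩ := exists_isStandardGenerating G
  refine IsGreatest.csSup_eq ⟨⟨extremalSet b, hb.extremal.aperiodic h2, hb.rhoMaximal,
    hb.closure_extremalSet, hb.ncard_extremalSet⟩, ?_⟩
  rintro n ⟨A, -, hA, hclos, rfl⟩
  exact ncard_le_cardBound hclos hA.prop

end Standard

end FinAbDiam

theorem corollary2p8 (G : Type*) [AddCommGroup G] [Finite G] (ρ : ℕ)
    (hρ : ρ = FinAbDiam.absDiam G) (hρ2 : 2 ≤ ρ) :
    FinAbDiam.tInvariant G ρ = FinAbDiam.sInvariant G ρ ∧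
    FinAbDiam.sInvariant G ρ =
      1 + 2 * FinAbDiam.rk G - FinAbDiam.nu G 2 + 2 * (FinAbDiam.nu G 3 / 2) ∧
    ∀ b : Fin (FinAbDiam.rk G) → G, FinAbDiam.IsStandardGenerating b →
      AddSubgroup.closure (FinAbDiam.extremalSet b) = ⊤ ∧
      FinAbDiam.RhoMaximal ρ (FinAbDiam.extremalSet b) ∧
      (FinAbDiam.extremalSet b).ncard =
        1 + 2 * FinAbDiam.rk G - FinAbDiam.nu G 2 + 2 * (FinAbDiam.nu G 3 / 2) ∧
      FinAbDiam.Aperiodic (FinAbDiam.extremalSet b) := by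
  rw [FinAbDiam.absDiam_eq_halfSum] at hρ
  subst hρ
  rw [← FinAbDiam.cardBound_eq, FinAbDiam.sInvariant_halfSum, FinAbDiam.tInvariant_halfSum hρ2]
  exact ⟨rfl, rfl, fun b hb => ⟨hb.closure_extremalSet, hb.rhoMaximal, hb.ncard_extremalSet,
    hb.extremal.aperiodic hρ2⟩⟩
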